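/- Let $H$ be an infinite-dimensional real Hilbert space, $\tilde H=H+iH$ its complexification with norm $|\cdot|$ and inner product $(\cdot,\cdot)$, and let $A:D(A)\subset H\to H$ be a densely defined, self-adjoint, positive definite operator with compact resolvent. Let $\{\phi_n\}_{n\ge1}$ be an orthonormal basis of $H$ of eigenvectors of $A$, $A\phi_n=\lambda_n\phi_n$, $\lambda_1\le\lambda_2\le\cdots$. Let $B\in\mathcal L(H)$, $\delta>0$ and $\beta(t)=e^{-\delta t}$ (that is, $\beta'+\delta\beta=0$, $\beta(0)=1$). $A$ and $B$ are extended complex-linearly to $\tilde H$. Consider $$\mathbf y'(t)+A\mathbf y(t)+\int_0^t\beta(t-s)A\mathbf y(s)\,ds=Bu(t)\quad(t\ge0),\qquad \mathbf y(0)=\mathbf y_0\in\tilde H .\tag{1}$$ A (weak) solution of (1) is a $\mathbf y\in C([0,\infty);\tilde H)$ with $\mathbf y(0)=\mathbf y_0$ and $\frac{d}{dt}(\mathbf y(t),\psi)+(\mathbf y(t),A\psi)+\int_0^t\beta(t-s)(\mathbf y(s),A\psi)\,ds=(Bu(t),\psi)$ for all $\psi\in D(A)$, $t\ge 0$; it is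 classical if $\mathbf y\in C^1([0,\infty);\tilde H)\cap C([0,\infty);D(A))$ and (1) holds in $\tilde H$. Put $$\mu_n^\pm=\tfrac12\Big(\lambda_n+\delta\pm\sqrt{(\lambda_n-\delta)^2-4\lambda_n}\Big)\in\mathbb C,\qquad \omega_0=\delta+1,$$ let $0<\gamma<\omega_0$, and let $N=\max\{N_1,N_2\}$ with $N_1=\sup\{j:\operatorname{Re}\mu_j^+\le\gamma\}$, $N_2=\sup\{j:\operatorname{Re}\mu_j^-\le\gamma\}$ ($\sup\emptyset=0$); $N$ is finite. Let the $l$ distinct values among $\lambda_1,\dots,\lambda_N$ have multiplicities $m_1,\dots,m_l$ (in increasing order of the values), and let $M=\max_k m_k$ ($M=0$ if $N=0$). For $\Phi_1,\dots,\Phi_M\in\tilde H$ set $$P_{2N}=\begin{pmatrix}0&I_N\\-\operatorname{diag}(\lambda_j(1+\delta))&-\operatorname{diag}(\lambda_j+\delta)\end{pmatrix},\qquad Q_{2NM}=\begin{pmatrix}0_{N\times M}\\ C_{NM}\end{pmatrix},\qquad (C_{NM})_{ji}=(B\Phi_i,\phi_j).$$ The eigenvalues of $P_{2N}$ are $-\mu_j^\pm$,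 $1\le j\le N$. For a $2N\times M$ matrix $\overline Q$ and $1\le k\le l$ let $\overline Q_k$ (resp. $\overline Q_{k+l}$) be the $M\times m_k$ submatrix of the conjugate transpose $\overline Q^*$ formed by the columns $j$ (resp. $N+j$) with $m_1+\dots+m_{k-1}<j\le m_1+\dots+m_k$. Assume one of the following. (a) All eigenvalues of $P_{2N}$ are semisimple, $\Phi_i=\phi_i$ for $1\le i\le M$, and for some invertible complex matrix $R$ with $P_{2N}=R^{-1}DR$, $D=\operatorname{diag}(-\mu_1^+,\dots,-\mu_N^+,-\mu_1^-,\dots,-\mu_N^-)$, the matrix $\overline Q=RQ_{2NM}$ satisfies $\operatorname{rank}\overline Q_k=\operatorname{rank}\overline Q_{k+l}=m_k$ for all $k=1,\dots,l$. (b) Not all eigenvalues of $P_{2N}$ are semisimple, $\Phi_1,\dots,\Phi_M\in\operatorname{span}_{\mathbb C}\{\phi_1,\dots,\phi_N\}$, and for some invertible complex matrix $\overline R$ with $P_{2N}=\overline R^{-1}J\overline R$, where $J$ is a matrix with diagonal $-\mu_1^+,\dots,-\mu_N^+,-\mu_1^-,\dots,-\mu_N^-$ (in this order) that is a Jordan matrix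 up to a permutation of the coordinates, the matrix $\overline Q=\overline RQ_{2NM}$ satisfies $\operatorname{rank}\overline Q_k=\operatorname{rank}\overline Q_{k+l}=m_k$ for all $k=1,\dots,l$. Then $\Phi_1,\dots,\Phi_M\in D(A)$, and controllers of the form $u(t)=\sum_{i=1}^M\Phi_iv_i(t)$ stabilize (1) exponentially with rate $\gamma$, in each of the following two ways. 1. For every $T>0$ there is a constant $C$ such that for every $\mathbf y_0\in\tilde H$ there are $v_1,\dots,v_M\in C([0,\infty);\mathbb C)$ and $w_1,\dots,w_M\in L^2(0,T;\mathbb C)$ with $$v_i(t)=-\int_t^T\beta(t-s)w_i(s)\,ds\ (0\le t\le T),\quad \int_0^T|w_i(t)|^2dt\le C|\mathbf y_0|^2,\quad v_i(t)=0=w_i(t)\ (t\ge T),$$ such that (1) with $u=\sum_i\Phi_iv_i$ has exactly one solution $\mathbf y$, this solution is classical if $\mathbf y_0\in D(A)$, and $|\mathbf y(t)|\le Ce^{-\gamma t}|\mathbf y_0|$ for all $t\ge0$. 2. There is a constant $C$ such that for every $\mathbf y_0\in\tilde H$ there are $v_1,\dots,v_M\in C^2([0,\infty);\mathbb C)$ with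 $$|v_j(t)|+|v_j'(t)|+|v_j''(t)|\le Ce^{-\gamma t}|\mathbf y_0|\qquad(t>0,\ j=1,\dots,M),$$ such that (1) with $u=\sum_i\Phi_iv_i$ has exactly one solution $\mathbf y$, this solution is classical if $\mathbf y_0\in D(A)$, and $|\mathbf y(t)|\le Ce^{-\gamma t}|\mathbf y_0|$ for all $t\ge0$. -/

import Mathlib

noncomputable section

/-! ### The complexification of a real Hilbert space -/

/-- The complexification `H + iH` of a real Hilbert space `H`: pairs `(x, y)`, thought of as
`x + iy`, with `‖x + iy‖² = ‖x‖² + ‖y‖²`. -/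
def Complexification (H : Type*) : Type _ := WithLp 2 (H × H)

namespace Complexification

section Basic

variable {H : Type*} [NormedAddCommGroup H]

instance : NormedAddCommGroup (Complexification H) :=
  inferInstanceAs (NormedAddCommGroup (WithLp 2 (H × H)))

instance [CompleteSpace H] : CompleteSpace (Complexification H) :=
  inferInstanceAs (CompleteSpace (WithLp 2 (H × H)))

/-- The element `x + iy`. -/
def mk (x y : H) : Complexification H := WithLp.toLp 2 (x, y)

/-- The real part. -/
def re (z : Complexification H) : H := (WithLp.ofLp z).1

/-- The imaginary part. -/
def im (z : Complexification H) : H := (WithLp.ofLp z).2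

@[simp] theorem re_mk (x y : H) : (mk x y).re = x := rfl
@[simp] theorem im_mk (x y : H) : (mk x y).im = y := rfl
@[simp] theorem re_add (z w : Complexification H) : (z + w).re = z.re + w.re := rfl
@[simp] theorem im_add (z w : Complexification H) : (z + w).im = z.im + w.im := rfl
@[simp] theorem re_zero : (0 : Complexification H).re = 0 := rfl
@[simp] theorem im_zero : (0 : Complexification H).im = 0 := rfl

theorem ext' {z w : Complexification H} (h₁ : z.re = w.re) (h₂ : z.im = w.im) : z = w :=
  WithLp.ofLp_injective 2 (Prod.ext h₁ h₂)

theorem norm_sq (z : Complexification H) : ‖z‖ ^ 2 = ‖z.re‖ ^ 2 + ‖z.im‖ ^ 2 :=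
  WithLp.prod_norm_sq_eq_of_L2 (α := H) (β := H) z

end Basic

section Inner

variable {H : Type*} [NormedAddCommGroup H] [InnerProductSpace ℝ H]

/-- `(a + ib)(x + iy) = (ax - by) + i(ay + bx)`. -/
instance : SMul ℂ (Complexification H) :=
  ⟨fun c z => mk (c.re • z.re - c.im • z.im) (c.re • z.im + c.im • z.re)⟩

@[simp] theorem re_smul (c : ℂ) (z : Complexification H) :
    (c • z).re = c.re • z.re - c.im • z.im := rfl
@[simp] theorem im_smul (c : ℂ) (z : Complexification H) :
    (c • z).im = c.re • z.im + c.im • z.re := rfl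

instance : Module ℂ (Complexification H) where
  one_smul z := ext' (by simp) (by simp)
  mul_smul c d z := ext' (by simp; module) (by simp; module)
  smul_zero c := ext' (by simp) (by simp)
  smul_add c z w := ext' (by simp; module) (by simp; module)
  add_smul c d z := ext' (by simp; module) (by simp; module)
  zero_smul z := ext' (by simp) (by simp)

theorem norm_smul_eq (c : ℂ) (z : Complexification H) : ‖c • z‖ = ‖c‖ * ‖z‖ := by
  have h : ‖c • z‖ ^ 2 = (‖c‖ * ‖z‖) ^ 2 := by
    rw [mul_pow, norm_sq, norm_sq, re_smul, im_smul, norm_sub_sq_real, norm_add_sq_real,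
      Complex.sq_norm, Complex.normSq_apply]
    simp only [norm_smul, inner_smul_left, inner_smul_right, mul_pow, Real.norm_eq_abs, sq_abs,
      real_inner_comm z.re z.im, RCLike.conj_to_real]
    ring
  exact (sq_eq_sq₀ (norm_nonneg _) (by positivity)).1 h

/-- The inner product `⟨x + iy, x' + iy'⟩ = (⟨x, x'⟩ + ⟨y, y'⟩) + i (⟨x, y'⟩ - ⟨y, x'⟩)`,
conjugate linear in the first argument. -/
instance : InnerProductSpace ℂ (Complexification H) where
  norm_smul_le c z := (norm_smul_eq c z).le
  inner z w := ⟨inner ℝ z.re w.re + inner ℝ z.im w.im, inner ℝ z.re w.im - inner ℝ z.im w.re⟩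
  norm_sq_eq_re_inner z := by
    rw [norm_sq]
    simp
  conj_inner_symm z w := by
    apply Complex.ext
    · simp [real_inner_comm]
    · simp [real_inner_comm]
  add_left z w x := by
    apply Complex.ext
    · simp [inner_add_left]; ring
    · simp [inner_add_left]; ring
  smul_left z w c := by
    apply Complex.ext
    · simp [inner_add_left, inner_sub_left, inner_smul_left]; ring
    · simp [inner_add_left, inner_sub_left, inner_smul_left]; ring

/-- The inclusion of `H` into its complexification. -/
def ofReal (x : H) : Complexification H := mk x 0

/-- The complex-linear extension `x + iy ↦ Bx + iBy` of a bounded operator `B` on `H`. -/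
def mapL (B : H →L[ℝ] H) : Complexification H →L[ℂ] Complexification H :=
  LinearMap.mkContinuous
    { toFun := fun z => mk (B z.re) (B z.im)
      map_add' := fun z w => ext' (by simp) (by simp)
      map_smul' := fun c z => ext' (by simp) (by simp) }
    ‖B‖ (fun z => by
      refine (sq_le_sq₀ (norm_nonneg _) (by positivity)).1 ?_
      rw [mul_pow, norm_sq, norm_sq, mul_add, ← mul_pow, ← mul_pow]
      exact add_le_add (pow_le_pow_left₀ (norm_nonneg _) (B.le_opNorm _) 2)
        (pow_le_pow_left₀ (norm_nonneg _) (B.le_opNorm _) 2))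

/-- The complex-linear extension `x + iy ↦ Ax + iAy` of an unbounded operator `A` on `H`, with
domain `D(A) + iD(A)`. -/
def mapPMap (A : H →ₗ.[ℝ] H) : Complexification H →ₗ.[ℂ] Complexification H where
  domain :=
    { carrier := {z | z.re ∈ A.domain ∧ z.im ∈ A.domain}
      add_mem' := fun ha hb => ⟨A.domain.add_mem ha.1 hb.1, A.domain.add_mem ha.2 hb.2⟩
      zero_mem' := ⟨A.domain.zero_mem, A.domain.zero_mem⟩
      smul_mem' := fun c _ hz =>
        ⟨A.domain.sub_mem (A.domain.smul_mem _ hz.1) (A.domain.smul_mem _ hz.2),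
          A.domain.add_mem (A.domain.smul_mem _ hz.2) (A.domain.smul_mem _ hz.1)⟩ }
  toFun :=
    { toFun := fun z => mk (A ⟨z.1.re, z.2.1⟩) (A ⟨z.1.im, z.2.2⟩)
      map_add' := fun z w => ext'
        (A.map_add ⟨z.1.re, z.2.1⟩ ⟨w.1.re, w.2.1⟩) (A.map_add ⟨z.1.im, z.2.2⟩ ⟨w.1.im, w.2.2⟩)
      map_smul' := fun c z => ext'
        (by
          have h := A.map_sub (c.re • ⟨z.1.re, z.2.1⟩) (c.im • ⟨z.1.im, z.2.2⟩)
          rw [A.map_smul, A.map_smul] at h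
          exact h)
        (by
          have h := A.map_add (c.re • ⟨z.1.im, z.2.2⟩) (c.im • ⟨z.1.re, z.2.1⟩)
          rw [A.map_smul, A.map_smul] at h
          exact h) }

end Inner

end Complexification

namespace PIDE

open Set MeasureTheory

/-! ### The operator and the controlled equation -/

section Equation

variable {H : Type*} [NormedAddCommGroup H] [InnerProductSpace ℝ H]

/-- Some real `r` lies in the resolvent set of `A` and `(r I - A)⁻¹` is a compact operator on the
whole space. -/
def HasCompactResolvent (A : H →ₗ.[ℝ] H) : Prop :=
  ∃ (r : ℝ) (K : H →L[ℝ] H), IsCompactOperator K ∧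
    (∀ x : H, ∃ h : K x ∈ A.domain, r • K x - A ⟨K x, h⟩ = x) ∧
    (∀ x : A.domain, K (r • (x : H) - A x) = x)

/-- The memory kernel: the solution of `β' + δ β = 0`, `β(0) = 1`. -/
def kernel (δ t : ℝ) : ℝ := Real.exp (-(δ * t))

/-- `y` is the (weak, equivalently mild) solution, on `[0, ∞)` and in the complexified space, of
`y' + A y + ∫₀ᵗ β(t - s) A y(s) ds = f(t)`, `y(0) = y₀`: it is continuous and
`d/dt ⟨y, ψ⟩ + ⟨y, A ψ⟩ + ∫₀ᵗ β(t - s) ⟨y(s), A ψ⟩ ds = ⟨f(t), ψ⟩` for all `ψ ∈ D(A)`. -/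
structure IsWeakSolution (A : H →ₗ.[ℝ] H) (δ : ℝ) (f : ℝ → Complexification H)
    (y₀ : Complexification H) (y : ℝ → Complexification H) : Prop where
  continuousOn : ContinuousOn y (Ici 0)
  initial : y 0 = y₀
  weak_eq : ∀ (ψ : (Complexification.mapPMap A).domain) (t : ℝ), 0 ≤ t →
    HasDerivWithinAt (fun s => inner ℂ (ψ : Complexification H) (y s))
      (inner ℂ (ψ : Complexification H) (f t)
        - inner ℂ (Complexification.mapPMap A ψ) (y t)
        - ∫ s in (0 : ℝ)..t,
            (kernel δ (t - s) : ℂ) * inner ℂ (Complexification.mapPMap A ψ) (y s))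
      (Ici 0) t

/-- `y ∈ C¹([0, ∞); H + iH) ∩ C([0, ∞); D(A))` is a classical solution of
`y' + A y + ∫₀ᵗ β(t - s) A y(s) ds = f(t)`, `y(0) = y₀`. Here `z(t) = A y(t)`, and continuity with
values in `D(A)` refers to the graph norm. -/
def IsClassicalSolution (A : H →ₗ.[ℝ] H) (δ : ℝ) (f : ℝ → Complexification H)
    (y₀ : Complexification H) (y : ℝ → Complexification H) : Prop :=
  ContDiffOn ℝ 1 y (Ici 0) ∧ y 0 = y₀ ∧
    ∃ z : ℝ → Complexification H, ContinuousOn z (Ici 0) ∧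
      (∀ t : ℝ, 0 ≤ t → (y t, z t) ∈ (Complexification.mapPMap A).graph) ∧
      ∀ t : ℝ, 0 ≤ t →
        HasDerivWithinAt y
          (f t - z t - ∫ s in (0 : ℝ)..t, (kernel δ (t - s) : ℂ) • z s) (Ici 0) t

/-- The controlled equation `y' + A y + ∫₀ᵗ β(t - s) A y(s) ds = B u(t)`, `y(0) = y₀`, has exactly
one solution on `[0, ∞)`; it is classical when `y₀ ∈ D(A)`; and it satisfies
`‖y(t)‖ ≤ C e^{-γ t} ‖y₀‖` for all `t ≥ 0`. -/
def Stabilizes (A : H →ₗ.[ℝ] H) (B : H →L[ℝ] H) (δ γ C : ℝ)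
    (u : ℝ → Complexification H) (y₀ : Complexification H) : Prop :=
  ∃ y : ℝ → Complexification H,
    IsWeakSolution A δ (fun t => Complexification.mapL B (u t)) y₀ y ∧
    (∀ z : ℝ → Complexification H,
      IsWeakSolution A δ (fun t => Complexification.mapL B (u t)) y₀ z → EqOn z y (Ici 0)) ∧
    (y₀ ∈ (Complexification.mapPMap A).domain →
      IsClassicalSolution A δ (fun t => Complexification.mapL B (u t)) y₀ y) ∧
    ∀ t : ℝ, 0 ≤ t → ‖y t‖ ≤ C * Real.exp (-(γ * t)) * ‖y₀‖

/-- The control `u(t) = ∑ᵢ vᵢ(t) Φᵢ`. -/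
def control {M : ℕ} (Φ : Fin M → Complexification H) (v : Fin M → ℝ → ℂ) :
    ℝ → Complexification H :=
  fun t => ∑ i, v i t • Φ i

end Equation

/-! ### The spectral data

The eigenvalues `lam 0 ≤ lam 1 ≤ ...` of `A` are numbered from `0`. -/

/-- A complex square root of the real number `x`: `√x` if `x ≥ 0` and `i √(-x)` if `x ≤ 0`. -/
def csqrt (x : ℝ) : ℂ := (Real.sqrt x : ℂ) + (Real.sqrt (-x) : ℂ) * Complex.I

/-- `μ⁺ = (l + δ + √((l - δ)² - 4 l)) / 2`. -/
def muPlus (δ l : ℝ) : ℂ := ((l + δ : ℝ) + csqrt ((l - δ) ^ 2 - 4 * l)) / 2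

/-- `μ⁻ = (l + δ - √((l - δ)² - 4 l)) / 2`. -/
def muMinus (δ l : ℝ) : ℂ := ((l + δ : ℝ) - csqrt ((l - δ) ^ 2 - 4 * l)) / 2

/-- `N = max (N₁, N₂)`, where `N₁` (resp. `N₂`) is the largest `j ≥ 1` such that the `j`-th
eigenvalue has `Re μ⁺ ≤ γ` (resp. `Re μ⁻ ≤ γ`), and `0` if there is none. -/
def unstableDim (lam : ℕ → ℝ) (δ γ : ℝ) : ℕ :=
  max (sSup {n : ℕ | ∃ j : ℕ, n = j + 1 ∧ (muPlus δ (lam j)).re ≤ γ})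
    (sSup {n : ℕ | ∃ j : ℕ, n = j + 1 ∧ (muMinus δ (lam j)).re ≤ γ})

/-- The number of occurrences of `lam j` among the first `N` eigenvalues. -/
def multiplicity (lam : ℕ → ℝ) (N : ℕ) (j : Fin N) : ℕ :=
  Fintype.card {i : Fin N // lam i = lam j}

/-- The maximal multiplicity among the first `N` eigenvalues (`0` if `N = 0`). -/
def maxMultiplicity (lam : ℕ → ℝ) (N : ℕ) : ℕ :=
  Finset.univ.sup (multiplicity lam N)

/-! ### The control matrix and the rank conditions -/

/-- The matrix `P = (0, I; -diag(l (1 + δ)), -diag(l + δ))`, of size `2N`. -/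
def matP (lam : ℕ → ℝ) (δ : ℝ) (N : ℕ) : Matrix (Fin N ⊕ Fin N) (Fin N ⊕ Fin N) ℂ :=
  Matrix.fromBlocks 0 1
    (-Matrix.diagonal fun j : Fin N => ((lam j * (1 + δ) : ℝ) : ℂ))
    (-Matrix.diagonal fun j : Fin N => ((lam j + δ : ℝ) : ℂ))

/-- The eigenvalues of `P` in the order `-μ₁⁺, ..., -μ_N⁺, -μ₁⁻, ..., -μ_N⁻`. -/
def eigList (lam : ℕ → ℝ) (δ : ℝ) (N : ℕ) : Fin N ⊕ Fin N → ℂ :=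
  Sum.elim (fun j => -muPlus δ (lam j)) (fun j => -muMinus δ (lam j))

/-- All the eigenvalues `-μ_j^±` of `P` are semisimple: every generalized eigenvector is an
eigenvector. -/
def SemisimpleSpectrum (lam : ℕ → ℝ) (δ : ℝ) (N : ℕ) : Prop :=
  ∀ k, Module.End.maxGenEigenspace (Matrix.toLin' (matP lam δ N)) (eigList lam δ N k) =
    Module.End.eigenspace (Matrix.toLin' (matP lam δ N)) (eigList lam δ N k)

/-- An upper triangular Jordan matrix: entries `0` or `1` on the superdiagonal, `1` only between
equal diagonal entries, and zero off the two diagonals. -/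
def IsJordanMatrix {n : ℕ} (J : Matrix (Fin n) (Fin n) ℂ) : Prop :=
  (∀ i j : Fin n, i ≠ j → (i : ℕ) + 1 ≠ j → J i j = 0) ∧
    ∀ i j : Fin n, (i : ℕ) + 1 = j → J i j = 0 ∨ (J i j = 1 ∧ J i i = J j j)

/-- `J` is a Jordan matrix with diagonal `d`. As `d` lists the eigenvalues in a prescribed order,
the coordinates of one Jordan block need not be consecutive, so `J` has the usual Jordan form only
after a permutation `e` of the coordinates. -/
def IsJordanWithDiag {ι : Type*} (d : ι → ℂ) (J : Matrix ι ι ℂ) : Prop :=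
  (∀ k, J k k = d k) ∧
    ∃ (n : ℕ) (e : ι ≃ Fin n), IsJordanMatrix (Matrix.reindex e e J)

/-- The block rank condition on the transformed control matrix `Q`, of size `2N × M`: for every
distinct eigenvalue `lam j`, of multiplicity `m`, the block of the columns of the conjugate
transpose `Q^*` with an index in the group of `lam j`, and the same block in the second half of
the columns, have rank `m`. -/
def BlockRank (lam : ℕ → ℝ) {N M : ℕ} (Q : Matrix (Fin N ⊕ Fin N) (Fin M) ℂ) : Prop :=
  ∀ j : Fin N,
    (Q.conjTranspose.submatrix id
      (fun i : {i : Fin N // lam i = lam j} => Sum.inl i.1)).rank = multiplicity lam N j ∧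
    (Q.conjTranspose.submatrix id
      (fun i : {i : Fin N // lam i = lam j} => Sum.inr i.1)).rank = multiplicity lam N j

section ControlMatrix

variable {H : Type*} [NormedAddCommGroup H] [InnerProductSpace ℝ H]

/-- The matrix `Q = (0; C)`, of size `2N × M`, with `C_{ji} = (B Φᵢ, φⱼ)`. -/
def matQ (B : H →L[ℝ] H) (φ : ℕ → H) (N : ℕ) {M : ℕ} (Φ : Fin M → Complexification H) :
    Matrix (Fin N ⊕ Fin N) (Fin M) ℂ :=
  Matrix.fromRows 0
    (Matrix.of fun (j : Fin N) (i : Fin M) =>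
      inner ℂ (Complexification.ofReal (φ j)) (Complexification.mapL B (Φ i)))

/-- The rank condition for semisimple eigenvalues, where `P = R⁻¹ D R` with
`D = diag(-μ₁⁺, ..., -μ_N⁺, -μ₁⁻, ..., -μ_N⁻)`. -/
def SemisimpleRankCondition (B : H →L[ℝ] H) (φ : ℕ → H) (lam : ℕ → ℝ) (δ : ℝ) (N : ℕ) {M : ℕ}
    (Φ : Fin M → Complexification H) : Prop :=
  ∃ R : Matrix (Fin N ⊕ Fin N) (Fin N ⊕ Fin N) ℂ, IsUnit R ∧
    matP lam δ N = R⁻¹ * Matrix.diagonal (eigList lam δ N) * R ∧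
    BlockRank lam (R * matQ B φ N Φ)

/-- The rank condition for non-semisimple eigenvalues, where `P = R⁻¹ J R` with a Jordan matrix
`J` with the diagonal `-μ₁⁺, ..., -μ_N⁺, -μ₁⁻, ..., -μ_N⁻`. -/
def JordanRankCondition (B : H →L[ℝ] H) (φ : ℕ → H) (lam : ℕ → ℝ) (δ : ℝ) (N : ℕ) {M : ℕ}
    (Φ : Fin M → Complexification H) : Prop :=
  ∃ R J : Matrix (Fin N ⊕ Fin N) (Fin N ⊕ Fin N) ℂ, IsUnit R ∧
    IsJordanWithDiag (eigList lam δ N) J ∧ matP lam δ N = R⁻¹ * J * R ∧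
    BlockRank lam (R * matQ B φ N Φ)

end ControlMatrix

end PIDE

end

namespace PIDE

open Set MeasureTheory Filter Topology

/-! ### Convolutions on the half line -/

/-! In the eigenbasis the equation splits into scalar modes. For a mode with eigenvalue `l`, put z =
∫ β(t-s) y(s) ds and p = y + z. This turns the memory equation into a planar system with constant
coefficients, y' = f - l p, z' = y - δ z, whose characteristic roots are -μ⁺ and -μ⁻.

Modes with index at least `N` decay by themselves. The energy p² + (1+δ)z² has no cross terms in its
derivative, so once l ≥ 2+δ the decay rate is 1+δ > γ with a constant independent of `l`
(`modeEnergy_le`). The finitely many remaining ones have γ < Re μ⁻ and are treated by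
triangularizing the planar system (`modeY_decay`).

The first `N` modes are steered exactly to rest at time `T`. Rest after `T` amounts to two moment
conditions per mode on the control (`respY_eq_zero`). These are solved by inverting a Gramian
weighted by a smooth cutoff, which makes the control C² and zero after `T` (`exists_moments`). The
Gramian is invertible by a Hautus argument (`eq_zero_of_modes_eq_zero`), which only needs the rows
(BΦᵢ, φⱼ)ᵢ to be independent within each group of equal eigenvalues. This independence is what the
rank conditions provide: a matrix R bringing P to diagonal or Jordan form can only mix coordinates
inside such a group, since a characteristic root determines its eigenvalue `l` (`row_supported`,
`rows_independent_of_blockRank`).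

After `T` the solution therefore lives on the stable modes, and on [0, T] a crude exponential bound
suffices. One family of controls serves both claims: w = v' + δv gives the integral representation,
and T = 1 gives the C² statement. -/

theorem continuous_integral_conv {V : Type*} [NormedAddCommGroup V] [NormedSpace ℂ V]
    {k : ℝ → ℂ} {u : ℝ → V} (hk : Continuous k) (hu : Continuous u) :
    Continuous fun t : ℝ => ∫ s in (0 : ℝ)..t, k (t - s) • u s := by
  apply intervalIntegral.continuous_parametric_intervalIntegral_of_continuous _ continuous_id
  exact (hk.comp (continuous_fst.sub continuous_snd)).smul (hu.comp continuous_snd)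

/-- Leibniz rule for a convolution with a `C¹` scalar kernel. -/
theorem hasDerivAt_integral_conv {V : Type*} [NormedAddCommGroup V] [NormedSpace ℂ V]
    [CompleteSpace V] {k k' : ℝ → ℂ} {u : ℝ → V} (hk : ∀ t, HasDerivAt k (k' t) t)
    (hk' : Continuous k') (hu : Continuous u) (t : ℝ) :
    HasDerivAt (fun t : ℝ => ∫ s in (0 : ℝ)..t, k (t - s) • u s)
      (k 0 • u t + ∫ s in (0 : ℝ)..t, k' (t - s) • u s) t := by
  have hkc : Continuous k := continuous_iff_continuousAt.2 fun t => (hk t).continuousAt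
  have c₁ : Continuous (Function.uncurry fun x s : ℝ => k' (x - s) • u s) :=
    (hk'.comp (continuous_fst.sub continuous_snd)).smul (hu.comp continuous_snd)
  have c₀ : ∀ x, Continuous fun s : ℝ => k (x - s) • u s := fun x =>
    (hkc.comp (continuous_const.sub continuous_id)).smul hu
  have hd₁ : ∀ x τ : ℝ, HasDerivAt (fun x => ∫ s in (0 : ℝ)..τ, k (x - s) • u s)
      (∫ s in (0 : ℝ)..τ, k' (x - s) • u s) x := by
    intro x τ
    obtain ⟨K, hK⟩ := ((isCompact_Icc (a := x - 1) (b := x + 1)).prod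
      (isCompact_uIcc (a := (0 : ℝ)) (b := τ))).exists_bound_of_continuousOn c₁.continuousOn
    refine (intervalIntegral.hasDerivAt_integral_of_dominated_loc_of_deriv_le
      (bound := fun _ => K) (F' := fun x s => k' (x - s) • u s)
      (Icc_mem_nhds (sub_one_lt x) (lt_add_one x)) ?_ ?_ ?_ ?_ ?_ ?_).2
    · exact Eventually.of_forall fun y => (c₀ y).aestronglyMeasurable
    · exact (c₀ x).intervalIntegrable _ _
    · exact (c₁.comp (continuous_const.prodMk continuous_id)).aestronglyMeasurable
    · exact Eventually.of_forall fun s hs y hy => hK (y, s) ⟨hy, uIoc_subset_uIcc hs⟩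
    · exact intervalIntegrable_const
    · refine Eventually.of_forall fun s _ y _ => ?_
      have := ((hk (y - s)).scomp y ((hasDerivAt_id y).sub_const s)).smul_const (u s)
      simpa using this
  have hd₂ : ∀ x τ : ℝ, HasDerivAt (fun τ => ∫ s in (0 : ℝ)..τ, k (x - s) • u s)
      (k (x - τ) • u τ) τ := fun x τ => (c₀ x).integral_hasStrictDerivAt 0 τ |>.hasDerivAt
  -- The parameter in the kernel and the upper limit are treated as independent variables;
  -- continuous partial derivatives give joint differentiability, and the chain rule along the
  -- diagonal t ↦ (t, t) concludes.
  have key := hasStrictFDerivAt_uncurry_coprod (𝕜 := ℝ) (u := (t, t))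
    (f := fun x τ : ℝ => ∫ s in (0 : ℝ)..τ, k (x - s) • u s)
    (f₁ := fun x τ => ContinuousLinearMap.toSpanSingleton ℝ (∫ s in (0 : ℝ)..τ, k' (x - s) • u s))
    (f₂ := fun x τ => ContinuousLinearMap.toSpanSingleton ℝ (k (x - τ) • u τ))
    (Eventually.of_forall fun v => (hd₁ v.1 v.2).hasFDerivAt)
    (Eventually.of_forall fun v => (hd₂ v.1 v.2).hasFDerivAt)
    (by
      refine Continuous.continuousAt ?_
      have : Continuous fun v : ℝ × ℝ => ∫ s in (0 : ℝ)..v.2, k' (v.1 - s) • u s :=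
        intervalIntegral.continuous_parametric_intervalIntegral_of_continuous
          (f := fun (v : ℝ × ℝ) s => k' (v.1 - s) • u s)
          (c₁.comp ((continuous_fst.comp continuous_fst).prodMk continuous_snd)) continuous_snd
      exact (ContinuousLinearMap.toSpanSingletonCLE (𝕜 := ℝ) (E := V)).continuous.comp this)
    (by
      refine Continuous.continuousAt ?_
      have : Continuous fun v : ℝ × ℝ => k (v.1 - v.2) • u v.2 :=
        (hkc.comp (continuous_fst.sub continuous_snd)).smul (hu.comp continuous_snd)
      exact (ContinuousLinearMap.toSpanSingletonCLE (𝕜 := ℝ) (E := V)).continuous.comp this)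
  have h2 := HasFDerivAt.comp_hasDerivAt (f := fun t : ℝ => (t, t)) t key.hasFDerivAt
    ((hasDerivAt_id t).prodMk (hasDerivAt_id t))
  refine h2.congr_deriv ?_
  simp [Function.HasUncurry.uncurry, add_comm]

theorem hasDerivAt_cexp_mul (μ : ℂ) (t : ℝ) :
    HasDerivAt (fun t : ℝ => Complex.exp (μ * t)) (μ * Complex.exp (μ * t)) t := by
  have h1 : HasDerivAt (fun s : ℝ => μ * (s : ℂ)) μ t := by
    simpa using ((hasDerivAt_id t).ofReal_comp).const_mul μ
  simpa [mul_comm] using h1.cexp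

/-- The scalar linear equation `z' = u - κ z`, `z(0) = 0`, on the half line. -/
theorem eq_integral_of_hasDerivAt {z u : ℝ → ℂ} {κ : ℝ} (hu : Continuous u)
    (h0 : z 0 = 0) (hz : ∀ t, HasDerivAt z (u t - κ * z t) t) (t : ℝ) :
    z t = ∫ s in (0 : ℝ)..t, (kernel κ (t - s) : ℂ) * u s := by
  have hd : ∀ s : ℝ, HasDerivAt (fun s : ℝ => Complex.exp (κ * s) * z s)
      (Complex.exp (κ * s) * u s) s := fun s =>
    ((hasDerivAt_cexp_mul κ s).mul (hz s)).congr_deriv (by ring)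
  have := intervalIntegral.integral_eq_sub_of_hasDerivAt (a := 0) (b := t) (fun s _ => hd s)
    (Continuous.intervalIntegrable (by fun_prop) _ _)
  have h2 : ∀ s : ℝ, (kernel κ (t - s) : ℂ) * u s
      = Complex.exp (-(κ * t)) * (Complex.exp (κ * s) * u s) := by
    intro s
    rw [← mul_assoc, ← Complex.exp_add, kernel]
    push_cast
    congr 2
    ring
  simp_rw [h2]
  rw [intervalIntegral.integral_const_mul, this, h0]
  simp [← mul_assoc, ← Complex.exp_add]

/-! ### One mode -/

/-- The generator of the system `p' = (1 - l) p - (1 + δ) z`, `z' = p - (1 + δ) z` satisfied, in a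
mode with eigenvalue `l`, by `z = ∫ β y` and `p = y + z`. -/
def modeGen (l δ : ℝ) : (ℝ × ℝ) →L[ℝ] (ℝ × ℝ) :=
  ((1 - l) • ContinuousLinearMap.fst ℝ ℝ ℝ - (1 + δ) • ContinuousLinearMap.snd ℝ ℝ ℝ).prod
    (ContinuousLinearMap.fst ℝ ℝ ℝ - (1 + δ) • ContinuousLinearMap.snd ℝ ℝ ℝ)

/-- The solution starting from `(1, 0)`. -/
noncomputable def modeState (l δ t : ℝ) : ℝ × ℝ := NormedSpace.exp (t • modeGen l δ) (1, 0)

noncomputable def modeP (l δ t : ℝ) : ℝ := (modeState l δ t).1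
noncomputable def modeZ (l δ t : ℝ) : ℝ := (modeState l δ t).2
noncomputable def modeY (l δ t : ℝ) : ℝ := modeP l δ t - modeZ l δ t

theorem hasDerivAt_modeState (l δ t : ℝ) :
    HasDerivAt (modeState l δ) (modeGen l δ (modeState l δ t)) t := by
  have h := hasDerivAt_exp_smul_const' (𝕂 := ℝ) (modeGen l δ) t
  exact ((ContinuousLinearMap.apply ℝ (ℝ × ℝ) ((1, 0) : ℝ × ℝ)).hasFDerivAt.comp_hasDerivAt t h)

theorem hasDerivAt_modeP (l δ t : ℝ) :
    HasDerivAt (modeP l δ) ((1 - l) * modeP l δ t - (1 + δ) * modeZ l δ t) t :=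
  (ContinuousLinearMap.fst ℝ ℝ ℝ).hasFDerivAt.comp_hasDerivAt t (hasDerivAt_modeState l δ t)

theorem hasDerivAt_modeZ (l δ t : ℝ) :
    HasDerivAt (modeZ l δ) (modeP l δ t - (1 + δ) * modeZ l δ t) t :=
  (ContinuousLinearMap.snd ℝ ℝ ℝ).hasFDerivAt.comp_hasDerivAt t (hasDerivAt_modeState l δ t)

@[simp] theorem modeState_zero (l δ : ℝ) : modeState l δ 0 = (1, 0) := by
  simp [modeState]

@[simp] theorem modeP_zero (l δ : ℝ) : modeP l δ 0 = 1 := by simp [modeP]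
@[simp] theorem modeZ_zero (l δ : ℝ) : modeZ l δ 0 = 0 := by simp [modeZ]
@[simp] theorem modeY_zero (l δ : ℝ) : modeY l δ 0 = 1 := by simp [modeY]

theorem hasDerivAt_modeY (l δ t : ℝ) : HasDerivAt (modeY l δ) (-l * modeP l δ t) t :=
  ((hasDerivAt_modeP l δ t).sub (hasDerivAt_modeZ l δ t)).congr_deriv (by ring)

theorem continuous_modeP (l δ : ℝ) : Continuous (modeP l δ) :=
  continuous_iff_continuousAt.2 fun t => (hasDerivAt_modeP l δ t).continuousAt
theorem continuous_modeZ (l δ : ℝ) : Continuous (modeZ l δ) :=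
  continuous_iff_continuousAt.2 fun t => (hasDerivAt_modeZ l δ t).continuousAt
theorem continuous_modeY (l δ : ℝ) : Continuous (modeY l δ) :=
  (continuous_modeP l δ).sub (continuous_modeZ l δ)

theorem contDiff_modeState (l δ : ℝ) {n : WithTop ℕ∞} : ContDiff ℝ n (modeState l δ) := by
  have h : ContDiff ℝ n (NormedSpace.exp : ((ℝ × ℝ) →L[ℝ] (ℝ × ℝ)) → _) :=
    contDiff_iff_contDiffAt.2 fun x => (NormedSpace.exp_analytic (𝕂 := ℝ) x).contDiffAt
  exact (h.comp (contDiff_id.smul contDiff_const)).clm_apply contDiff_const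

theorem contDiff_modeP (l δ : ℝ) {n : WithTop ℕ∞} : ContDiff ℝ n (modeP l δ) :=
  contDiff_fst.comp (contDiff_modeState l δ)
theorem contDiff_modeZ (l δ : ℝ) {n : WithTop ℕ∞} : ContDiff ℝ n (modeZ l δ) :=
  contDiff_snd.comp (contDiff_modeState l δ)

/-- The group law separates the variables t and s. Hence a response at time t to a forcing depends
on the forcing only through its moments against `modeP` and `modeZ` at -s. -/
theorem modeState_sub (l δ t s : ℝ) :
    modeState l δ (t - s) = modeP l δ (-s) • modeState l δ t
      + modeZ l δ (-s) • NormedSpace.exp (t • modeGen l δ) (0, 1) := by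
  let _ := NormedAlgebra.restrictScalars ℚ ℝ ((ℝ × ℝ) →L[ℝ] (ℝ × ℝ))
  have h1 : NormedSpace.exp ((t - s) • modeGen l δ)
      = NormedSpace.exp (t • modeGen l δ) * NormedSpace.exp ((-s) • modeGen l δ) := by
    rw [← NormedSpace.exp_add_of_commute ((Commute.refl _).smul_left _ |>.smul_right _), ← add_smul,
      sub_eq_add_neg]
  have h2 : NormedSpace.exp ((-s) • modeGen l δ) (1, 0)
      = modeP l δ (-s) • ((1, 0) : ℝ × ℝ) + modeZ l δ (-s) • ((0, 1) : ℝ × ℝ) := by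
    ext <;> simp [modeP, modeZ, modeState]
  simp only [modeState]
  rw [h1, mul_apply_eq_comp, h2, map_add, map_smul, map_smul]

/-- The weight 1+δ on z² is chosen so that the mixed terms ∓2(1+δ)pz in the derivative cancel. What
remains is dissipated at the rates l-1 and 1+δ separately, so the estimate has constant 1 and is
uniform in `l`. -/
theorem modeEnergy_le {l δ κ : ℝ} (hδ : 0 ≤ δ) (h1 : 1 - l ≤ κ) (h2 : -(1 + δ) ≤ κ) {t : ℝ}
    (ht : 0 ≤ t) :
    modeP l δ t ^ 2 + (1 + δ) * modeZ l δ t ^ 2 ≤ Real.exp (κ * t) ^ 2 := by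
  set g : ℝ → ℝ := fun t =>
    Real.exp (-2 * κ * t) * (modeP l δ t ^ 2 + (1 + δ) * modeZ l δ t ^ 2) with hg
  have hd : ∀ t, HasDerivAt g (Real.exp (-2 * κ * t) *
      (2 * (1 - l - κ) * modeP l δ t ^ 2 + 2 * (1 + δ) * (-(1 + δ) - κ) * modeZ l δ t ^ 2)) t := by
    intro t
    have e1 : HasDerivAt (fun t : ℝ => Real.exp (-2 * κ * t))
        (Real.exp (-2 * κ * t) * (-2 * κ)) t := by
      simpa using ((hasDerivAt_id t).const_mul (-2 * κ)).exp
    refine (e1.mul (((hasDerivAt_modeP l δ t).pow 2).add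
      (((hasDerivAt_modeZ l δ t).pow 2).const_mul (1 + δ)))).congr_deriv ?_
    simp only [Pi.add_apply, Pi.pow_apply]
    push_cast
    ring
  have hanti : Antitone g := antitone_of_hasDerivAt_nonpos hd fun t => by
    refine mul_nonpos_of_nonneg_of_nonpos (Real.exp_pos _).le ?_
    have := mul_nonneg (sub_nonneg.2 h1) (sq_nonneg (modeP l δ t))
    have h4 : 0 ≤ (1 + δ) * (κ + (1 + δ)) * modeZ l δ t ^ 2 :=
      mul_nonneg (mul_nonneg (by linarith) (by linarith)) (sq_nonneg _)
    nlinarith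
  have h3 := hanti ht
  simp only [hg, modeP_zero, modeZ_zero, mul_zero, Real.exp_zero] at h3
  have h4 : Real.exp (κ * t) ^ 2 * Real.exp (-2 * κ * t) = 1 := by
    rw [← Real.exp_nat_mul, ← Real.exp_add]
    simp
    ring
  calc _ = Real.exp (κ * t) ^ 2 * (Real.exp (-2 * κ * t)
        * (modeP l δ t ^ 2 + (1 + δ) * modeZ l δ t ^ 2)) := by rw [← mul_assoc, h4, one_mul]
    _ ≤ Real.exp (κ * t) ^ 2 * 1 := by gcongr; simpa using h3
    _ = _ := mul_one _

theorem abs_modeP_le {l δ κ : ℝ} (hδ : 0 ≤ δ) (h1 : 1 - l ≤ κ) (h2 : -(1 + δ) ≤ κ) {t : ℝ}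
    (ht : 0 ≤ t) : |modeP l δ t| ≤ Real.exp (κ * t) := by
  refine abs_le_of_sq_le_sq ?_ (Real.exp_pos _).le
  have := modeEnergy_le hδ h1 h2 ht
  nlinarith [sq_nonneg (modeZ l δ t), mul_nonneg hδ (sq_nonneg (modeZ l δ t))]

theorem abs_modeZ_le {l δ κ : ℝ} (hδ : 0 ≤ δ) (h1 : 1 - l ≤ κ) (h2 : -(1 + δ) ≤ κ) {t : ℝ}
    (ht : 0 ≤ t) : |modeZ l δ t| ≤ Real.exp (κ * t) := by
  refine abs_le_of_sq_le_sq ?_ (Real.exp_pos _).le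
  have := modeEnergy_le hδ h1 h2 ht
  nlinarith [sq_nonneg (modeP l δ t), mul_nonneg hδ (sq_nonneg (modeZ l δ t))]

theorem abs_modeY_le {l δ κ : ℝ} (hδ : 0 ≤ δ) (h1 : 1 - l ≤ κ) (h2 : -(1 + δ) ≤ κ) {t : ℝ}
    (ht : 0 ≤ t) : |modeY l δ t| ≤ 2 * Real.exp (κ * t) :=
  (abs_sub _ _).trans (by
    linarith [abs_modeP_le hδ h1 h2 ht, abs_modeZ_le hδ h1 h2 ht])

/-! ### The response of one mode to a forcing term -/

/-- Here `c` is the initial value of y; since z starts at 0, it is also that of p. The forcing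
enters y and p but not z directly, so an impulse acts as the initial state (1, 0) and all three
kernels come from `modeState`. -/
noncomputable def respP (l δ : ℝ) (c : ℂ) (f : ℝ → ℂ) (t : ℝ) : ℂ :=
  modeP l δ t * c + ∫ s in (0 : ℝ)..t, (modeP l δ (t - s) : ℂ) • f s
noncomputable def respZ (l δ : ℝ) (c : ℂ) (f : ℝ → ℂ) (t : ℝ) : ℂ :=
  modeZ l δ t * c + ∫ s in (0 : ℝ)..t, (modeZ l δ (t - s) : ℂ) • f s
noncomputable def respY (l δ : ℝ) (c : ℂ) (f : ℝ → ℂ) (t : ℝ) : ℂ :=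
  modeY l δ t * c + ∫ s in (0 : ℝ)..t, (modeY l δ (t - s) : ℂ) • f s

theorem respY_eq (l δ : ℝ) (c : ℂ) {f : ℝ → ℂ} (hf : Continuous f) (t : ℝ) :
    respY l δ c f t = respP l δ c f t - respZ l δ c f t := by
  have hP : Continuous fun s : ℝ => (modeP l δ (t - s) : ℂ) • f s := by
    have := continuous_modeP l δ
    fun_prop
  have hZ : Continuous fun s : ℝ => (modeZ l δ (t - s) : ℂ) • f s := by
    have := continuous_modeZ l δ
    fun_prop
  have h : ∀ s : ℝ, (modeY l δ (t - s) : ℂ) • f s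
      = (modeP l δ (t - s) : ℂ) • f s - (modeZ l δ (t - s) : ℂ) • f s := by
    intro s
    simp only [modeY, Complex.ofReal_sub, sub_smul]
  simp only [respY, respP, respZ, h]
  rw [intervalIntegral.integral_sub (hP.intervalIntegrable _ _) (hZ.intervalIntegrable _ _), modeY]
  push_cast
  ring

theorem hasDerivAt_respZ (l δ : ℝ) (c : ℂ) {f : ℝ → ℂ} (hf : Continuous f) (t : ℝ) :
    HasDerivAt (respZ l δ c f) (respY l δ c f t - δ * respZ l δ c f t) t := by
  have hY := continuous_modeY l δ
  have hZ := continuous_modeZ l δ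
  have hd : ∀ t, HasDerivAt (fun t => (modeZ l δ t : ℂ)) (modeY l δ t - δ * modeZ l δ t : ℂ) t :=
    fun t => (hasDerivAt_modeZ l δ t).ofReal_comp.congr_deriv (by simp only [modeY]; push_cast; ring)
  refine (((hd t).mul_const c).add
    (hasDerivAt_integral_conv hd (by fun_prop) hf t)).congr_deriv ?_
  have h : ∀ s : ℝ, (modeY l δ (t - s) - δ * modeZ l δ (t - s) : ℂ) • f s
      = (modeY l δ (t - s) : ℂ) • f s - δ * ((modeZ l δ (t - s) : ℂ) • f s) := by
    intro s; simp only [smul_eq_mul]; ring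
  simp_rw [h]
  rw [intervalIntegral.integral_sub (Continuous.intervalIntegrable (by fun_prop) _ _)
    (Continuous.intervalIntegrable (by fun_prop) _ _), intervalIntegral.integral_const_mul]
  simp only [respY, respZ, modeZ_zero]
  push_cast
  simp only [zero_smul]
  ring

theorem hasDerivAt_respY (l δ : ℝ) (c : ℂ) {f : ℝ → ℂ} (hf : Continuous f) (t : ℝ) :
    HasDerivAt (respY l δ c f) (f t - l * respP l δ c f t) t := by
  have hP := continuous_modeP l δ
  have hd : ∀ t, HasDerivAt (fun t => (modeY l δ t : ℂ)) (-l * modeP l δ t : ℂ) t :=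
    fun t => (hasDerivAt_modeY l δ t).ofReal_comp.congr_deriv (by push_cast; ring)
  refine (((hd t).mul_const c).add
    (hasDerivAt_integral_conv hd (by fun_prop) hf t)).congr_deriv ?_
  have h : ∀ s : ℝ, (-l * modeP l δ (t - s) : ℂ) • f s
      = -l * ((modeP l δ (t - s) : ℂ) • f s) := by
    intro s; simp only [smul_eq_mul]; ring
  simp_rw [h]
  rw [intervalIntegral.integral_const_mul]
  simp only [respP, modeY_zero]
  push_cast
  simp only [one_smul]
  ring

@[simp] theorem respZ_zero (l δ : ℝ) (c : ℂ) (f : ℝ → ℂ) : respZ l δ c f 0 = 0 := by simp [respZ]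
@[simp] theorem respY_zero (l δ : ℝ) (c : ℂ) (f : ℝ → ℂ) : respY l δ c f 0 = c := by simp [respY]

theorem continuous_respY (l δ : ℝ) (c : ℂ) {f : ℝ → ℂ} (hf : Continuous f) :
    Continuous (respY l δ c f) :=
  continuous_iff_continuousAt.2 fun t => (hasDerivAt_respY l δ c hf t).continuousAt
theorem continuous_respZ (l δ : ℝ) (c : ℂ) {f : ℝ → ℂ} (hf : Continuous f) :
    Continuous (respZ l δ c f) :=
  continuous_iff_continuousAt.2 fun t => (hasDerivAt_respZ l δ c hf t).continuousAt
theorem continuous_respP (l δ : ℝ) (c : ℂ) {f : ℝ → ℂ} (hf : Continuous f) :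
    Continuous (respP l δ c f) := by
  have : respP l δ c f = fun t => respY l δ c f t + respZ l δ c f t := by
    ext t
    rw [respY_eq l δ c hf]
    ring
  rw [this]
  exact (continuous_respY l δ c hf).add (continuous_respZ l δ c hf)

/-- A control which vanishes after time `T` and solves the moment problem of a mode brings this
mode to rest at time `T`. -/
theorem respY_eq_zero {l δ T : ℝ} {c : ℂ} {f : ℝ → ℂ} (hf : Continuous f)
    (hfT : ∀ t, T ≤ t → f t = 0)
    (h1 : ∫ s in (0 : ℝ)..T, (modeP l δ (-s) : ℂ) * f s = -c)
    (h2 : ∫ s in (0 : ℝ)..T, (modeZ l δ (-s) : ℂ) * f s = 0) {t : ℝ} (ht : T ≤ t) :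
    respY l δ c f t = 0 := by
  have hP := continuous_modeP l δ
  have hZ := continuous_modeZ l δ
  have hY := continuous_modeY l δ
  -- The y-component at time t of the solution that starts from the second basis state (0, 1).
  set a : ℝ := (NormedSpace.exp (t • modeGen l δ) (0, 1)).1
    - (NormedSpace.exp (t • modeGen l δ) (0, 1)).2
  have hs : ∀ s : ℝ, (modeY l δ (t - s) : ℂ) • f s
      = modeY l δ t * ((modeP l δ (-s) : ℂ) * f s) + a * ((modeZ l δ (-s) : ℂ) * f s) := by
    intro s
    have : modeY l δ (t - s) = modeY l δ t * modeP l δ (-s) + a * modeZ l δ (-s) := by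
      have h := modeState_sub l δ t s
      have e1 := congrArg Prod.fst h
      have e2 := congrArg Prod.snd h
      simp only [Prod.fst_add, Prod.smul_fst, Prod.snd_add, Prod.smul_snd, smul_eq_mul] at e1 e2
      simp only [modeY, a]
      rw [show modeP l δ (t - s) = _ from e1, show modeZ l δ (t - s) = _ from e2]
      simp only [modeP, modeZ]
      ring
    rw [this, smul_eq_mul]
    push_cast
    ring
  have hc : Continuous fun s : ℝ => (modeY l δ (t - s) : ℂ) • f s := by fun_prop
  have h0 : ∫ s in T..t, (modeY l δ (t - s) : ℂ) • f s = 0 := by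
    rw [intervalIntegral.integral_congr (g := fun _ => (0 : ℂ)), intervalIntegral.integral_zero]
    intro s hs
    rw [uIcc_of_le ht] at hs
    simp [hfT s hs.1]
  rw [respY, ← intervalIntegral.integral_add_adjacent_intervals (hc.intervalIntegrable 0 T)
    (hc.intervalIntegrable T t), h0]
  simp_rw [hs]
  rw [intervalIntegral.integral_add (Continuous.intervalIntegrable (by fun_prop) _ _)
    (Continuous.intervalIntegrable (by fun_prop) _ _), intervalIntegral.integral_const_mul,
    intervalIntegral.integral_const_mul, h1, h2]
  ring

/-! ### The moment problem -/

/-- If no nontrivial combination of the rows `θ k` vanishes on `[0, T)`, the moments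
`∫₀ᵀ ∑ᵢ θ k i v i` can be prescribed by a `C²` function `v` that vanishes after time `T`. -/
theorem exists_moments {ι κ : Type*} [Fintype ι] [Fintype κ] {T : ℝ} (hT : 0 < T)
    (θ : ι → κ → ℝ → ℂ) (hθ : ∀ k i, ContDiff ℝ 2 (θ k i))
    (hindep : ∀ a : ι → ℂ, (∀ i, ∀ s ∈ Ico 0 T, ∑ k, a k * θ k i s = 0) → a = 0) (w : ι → ℂ) :
    ∃ v : κ → ℝ → ℂ, (∀ i, ContDiff ℝ 2 (v i)) ∧ (∀ i t, T ≤ t → v i t = 0) ∧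
      ∀ k, ∫ s in (0 : ℝ)..T, ∑ i, θ k i s * v i s = w k := by
  set η : ℝ → ℝ := fun s => Real.smoothTransition (T - s) with hη
  have hηd : ContDiff ℝ 2 η := Real.smoothTransition.contDiff.comp (contDiff_const.sub contDiff_id)
  have hηpos : ∀ s < T, 0 < η s := fun s hs => Real.smoothTransition.pos_of_pos (sub_pos.2 hs)
  -- The usual minimal-norm ansatz, conjugate rows as controls, damped by a cutoff that is positive
  -- before `T` and vanishes smoothly at `T`. The map `L` below is then a weighted Gramian.
  set V : (ι → ℂ) → κ → ℝ → ℂ := fun c i s => η s * ∑ l, c l * (starRingEnd ℂ) (θ l i s) with hV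
  have hVd : ∀ c i, ContDiff ℝ 2 (V c i) := fun c i =>
    (Complex.ofRealCLM.contDiff.comp hηd).mul (ContDiff.sum fun l _ =>
      contDiff_const.mul (Complex.conjCLE.contDiff.comp (hθ l i)))
  have hint : ∀ c k, IntervalIntegrable (fun s => ∑ i, θ k i s * V c i s) volume 0 T := fun c k =>
    Continuous.intervalIntegrable (continuous_finsetSum _ fun i _ =>
      (hθ k i).continuous.mul (hVd c i).continuous) _ _
  let L : (ι → ℂ) →ₗ[ℂ] (ι → ℂ) :=
    { toFun := fun c k => ∫ s in (0 : ℝ)..T, ∑ i, θ k i s * V c i s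
      map_add' := fun c d => by
        funext k
        rw [Pi.add_apply, ← intervalIntegral.integral_add (hint c k) (hint d k)]
        congr 1
        funext s
        simp only [hV, Pi.add_apply, add_mul, Finset.sum_add_distrib, mul_add]
      map_smul' := fun r c => by
        funext k
        rw [Pi.smul_apply, smul_eq_mul, ← intervalIntegral.integral_const_mul]
        congr 1
        funext s
        simp only [hV, Pi.smul_apply, smul_eq_mul, RingHom.id_apply, Finset.mul_sum]
        refine Finset.sum_congr rfl fun i _ => Finset.sum_congr rfl fun j _ => by ring }
  have hinj : Function.Injective L := by
    rw [← LinearMap.ker_eq_bot, LinearMap.ker_eq_bot']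
    intro c hc
    -- Pairing `L c` with the conjugate of `c` gives the quadratic form ∫ η ∑ᵢ |∑ₖ aₖ θₖᵢ|². If `L c
    -- = 0`, its continuous nonnegative integrand has integral 0, so the combination of rows
    -- vanishes wherever the cutoff is positive.
    set a : ι → ℂ := fun k => (starRingEnd ℂ) (c k) with ha
    set g : ℝ → ℝ := fun s => η s * ∑ i, Complex.normSq (∑ k, a k * θ k i s) with hg
    have hgc : Continuous g := by
      refine hηd.continuous.mul (continuous_finsetSum _ fun i _ => Complex.continuous_normSq.comp
        (continuous_finsetSum _ fun k _ => continuous_const.mul (hθ k i).continuous))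
    have hg0 : ∫ s in (0 : ℝ)..T, g s = 0 := by
      have h1 : ∑ k, a k * L c k = ∫ s in (0 : ℝ)..T, (g s : ℂ) := by
        simp only [L, LinearMap.coe_mk, AddHom.coe_mk, ← intervalIntegral.integral_const_mul]
        rw [← intervalIntegral.integral_finsetSum fun k _ => (hint c k).const_mul _]
        congr 1
        funext s
        simp only [hg, hV, Complex.ofReal_mul, Complex.ofReal_sum, Complex.normSq_eq_conj_mul_self,
          Finset.mul_sum, map_sum, map_mul, Finset.sum_mul, ha, Complex.conj_conj]
        rw [Finset.sum_comm]
        refine Finset.sum_congr rfl fun i _ => Finset.sum_congr rfl fun j _ =>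
          Finset.sum_congr rfl fun k _ => by ring
      rw [hc, intervalIntegral.integral_ofReal] at h1
      simpa using h1.symm
    have hgnn : ∀ s, 0 ≤ g s := fun s => mul_nonneg (Real.smoothTransition.nonneg _)
      (Finset.sum_nonneg fun i _ => Complex.normSq_nonneg _)
    have ha0 : a = 0 := by
      refine hindep a fun i s hs => ?_
      by_contra hne
      refine (intervalIntegral.integral_pos hT hgc.continuousOn (fun s _ => hgnn s)
        ⟨s, ⟨hs.1, hs.2.le⟩, mul_pos (hηpos s hs.2) ?_⟩).ne' hg0
      exact Finset.sum_pos' (fun i _ => Complex.normSq_nonneg _)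
        ⟨i, Finset.mem_univ _, Complex.normSq_pos.2 hne⟩
    funext k
    have := congrFun ha0 k
    simpa [ha] using this
  obtain ⟨c, hc⟩ := (LinearMap.injective_iff_surjective.1 hinj) w
  refine ⟨V c, hVd c, fun i t ht => ?_, fun k => congrFun hc k⟩
  have : η t = 0 := Real.smoothTransition.zero_of_nonpos (by linarith)
  simp [hV, this]

/-- The Hautus test for the modes: the rows of the moment problem are linearly independent if, in
each group of equal eigenvalues, the rows of the control matrix are. -/
theorem eq_zero_of_modes_eq_zero {N M : ℕ} {lam : Fin N → ℝ} {δ T : ℝ} (hδ : 0 < δ) (hT : 0 < T)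
    {C : Fin N → Fin M → ℂ}
    (hC : ∀ (l : ℝ) (a : Fin N → ℂ), (∀ n, lam n ≠ l → a n = 0) →
      (∀ i, ∑ n, a n * C n i = 0) → a = 0)
    {x : Fin N → ℂ × ℂ}
    (hx : ∀ i, ∀ s ∈ Ico 0 T, ∑ n, C n i *
      ((x n).1 * modeP (lam n) δ (-s) + (x n).2 * modeZ (lam n) δ (-s)) = 0) : x = 0 := by
  let V : Submodule ℂ (Fin N → ℂ × ℂ) :=
    { carrier := {x | ∀ i, ∀ s ∈ Ico 0 T, ∑ n, C n i *
        ((x n).1 * modeP (lam n) δ (-s) + (x n).2 * modeZ (lam n) δ (-s)) = 0}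
      add_mem' := fun {x y} hx hy i s hs => by
        rw [← add_zero (0 : ℂ)]
        nth_rw 1 [← hx i s hs]
        rw [← hy i s hs, ← Finset.sum_add_distrib]
        refine Finset.sum_congr rfl fun n _ => ?_
        simp only [Pi.add_apply, Prod.fst_add, Prod.snd_add]
        ring
      zero_mem' := fun i s _ => by simp
      smul_mem' := fun c x hx i s hs => by
        rw [← mul_zero c, ← hx i s hs, Finset.mul_sum]
        refine Finset.sum_congr rfl fun n _ => ?_
        simp only [Pi.smul_apply, Prod.smul_fst, Prod.smul_snd, smul_eq_mul]
        ring }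
  -- The transpose of the mode generator, acting on coefficients. Differentiating the vanishing
  -- identity in `s` replaces `x` by `-F x`, so the space `V` of relations is invariant under `F`.
  let F : (Fin N → ℂ × ℂ) →ₗ[ℂ] (Fin N → ℂ × ℂ) :=
    { toFun := fun x n => ((1 - lam n) * (x n).1 + (x n).2, -(1 + δ) * ((x n).1 + (x n).2))
      map_add' := fun x y => by
        funext n
        ext <;> simp only [Pi.add_apply, Prod.fst_add, Prod.snd_add] <;> ring
      map_smul' := fun c x => by
        funext n
        ext <;> simp only [Pi.smul_apply, Prod.smul_fst, Prod.smul_snd, smul_eq_mul,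
          RingHom.id_apply] <;> ring }
  have hF : ∀ x ∈ V, F x ∈ V := by
    intro x hx i s hs
    have hd : HasDerivAt (fun s : ℝ => ∑ n, C n i *
        ((x n).1 * modeP (lam n) δ (-s) + (x n).2 * modeZ (lam n) δ (-s)))
        (-∑ n, C n i * ((F x n).1 * modeP (lam n) δ (-s) + (F x n).2 * modeZ (lam n) δ (-s))) s := by
      rw [← Finset.sum_neg_distrib]
      refine HasDerivAt.fun_sum fun n _ => ?_
      have h1 : HasDerivAt (fun s : ℝ => (modeP (lam n) δ (-s) : ℂ)) _ s :=
        ((hasDerivAt_modeP (lam n) δ (-s)).scomp s (hasDerivAt_neg s)).ofReal_comp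
      have h2 : HasDerivAt (fun s : ℝ => (modeZ (lam n) δ (-s) : ℂ)) _ s :=
        ((hasDerivAt_modeZ (lam n) δ (-s)).scomp s (hasDerivAt_neg s)).ofReal_comp
      refine (((h1.const_mul (x n).1).add (h2.const_mul (x n).2)).const_mul (C n i)).congr_deriv ?_
      simp only [F, LinearMap.coe_mk, AddHom.coe_mk, smul_eq_mul]
      push_cast
      ring
    have hu : UniqueDiffWithinAt ℝ (Ico 0 T) s := uniqueDiffOn_Ico 0 T s hs
    have h0 : HasDerivWithinAt (fun s : ℝ => ∑ n, C n i *
        ((x n).1 * modeP (lam n) δ (-s) + (x n).2 * modeZ (lam n) δ (-s))) 0 (Ico 0 T) s :=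
      (hasDerivWithinAt_const s (Ico 0 T) (0 : ℂ)).congr (fun r hr => hx i r hr) (hx i s hs)
    have := hu.eq_deriv _ hd.hasDerivWithinAt h0
    exact neg_eq_zero.1 this
  by_contra hne
  -- A nonzero invariant subspace over ℂ contains an eigenvector of `F`, and it is enough to exclude
  -- that one.
  have hVn : Nontrivial V := ⟨⟨⟨x, hx⟩, 0, fun h => hne (congrArg Subtype.val h)⟩⟩
  obtain ⟨ν, hν⟩ := Module.End.exists_eigenvalue (F.restrict hF)
  obtain ⟨⟨y, hyV⟩, hy⟩ := hν.exists_hasEigenvector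
  have hy0 : y ≠ 0 := fun h => hy.2 (Subtype.ext h)
  have hyF : F y = ν • y := congrArg Subtype.val hy.apply_eq_smul
  have e1 : ∀ n, (1 - lam n) * (y n).1 + (y n).2 = ν * (y n).1 := fun n =>
    congrArg Prod.fst (congrFun hyF n)
  have e2 : ∀ n, -(1 + δ) * ((y n).1 + (y n).2) = ν * (y n).2 := fun n =>
    congrArg Prod.snd (congrFun hyF n)
  -- Eliminating the second component leaves the characteristic equation, which is affine in the
  -- eigenvalue of `A`. Its coefficient ν+1+δ cannot vanish, so ν determines that eigenvalue and the
  -- eigenvector is supported in a single group.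
  have e3 : ∀ n, (y n).1 ≠ 0 → lam n * (ν + 1 + δ) = -ν * (ν + δ) := by
    intro n hn
    have h2 : (y n).2 = (ν - 1 + lam n) * (y n).1 := by linear_combination e1 n
    have h3 := e2 n
    rw [h2] at h3
    have : (lam n * (ν + 1 + δ) - -ν * (ν + δ)) * (y n).1 = 0 := by linear_combination -h3
    exact sub_eq_zero.1 ((mul_eq_zero.1 this).resolve_right hn)
  have hν1 : ∀ n, (y n).1 ≠ 0 → ν + 1 + δ ≠ 0 := by
    intro n hn h
    have h3 := e3 n hn
    rw [h, mul_zero] at h3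
    have h4 : ν = -(1 + δ) := by linear_combination h
    rw [h4] at h3
    have : (1 + δ : ℂ) = 0 := by linear_combination h3
    have : (1 + δ : ℝ) = 0 := by exact_mod_cast this
    linarith
  have hsame : ∀ n m, (y n).1 ≠ 0 → (y m).1 ≠ 0 → lam n = lam m := by
    intro n m hn hm
    have := mul_right_cancel₀ (hν1 n hn) ((e3 n hn).trans (e3 m hm).symm)
    exact_mod_cast this
  have ha : (fun n => (y n).1) = 0 := by
    by_contra hne'
    obtain ⟨m, hm⟩ := Function.ne_iff.1 hne'
    refine hne' (hC (lam m) _ (fun n hn => ?_) fun i => ?_)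
    · by_contra h
      exact hn (hsame n m h hm)
    -- At s = 0 one has `modeP = 1` and `modeZ = 0`: the relation reduces to one between the rows of
    -- `C` within one group.
    · have := hyV i 0 ⟨le_rfl, hT⟩
      simpa [mul_comm] using this
  refine hy0 (funext fun n => Prod.ext (congrFun ha n) ?_)
  have h1 : (y n).1 = 0 := congrFun ha n
  have := e1 n
  rw [h1] at this
  simpa using this

/-- Null controllability of the first modes: a basic control for each of them. -/
theorem exists_mode_control {N M : ℕ} {lam : Fin N → ℝ} {δ T : ℝ} (hδ : 0 < δ) (hT : 0 < T)
    {C : Fin N → Fin M → ℂ}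
    (hC : ∀ (l : ℝ) (a : Fin N → ℂ), (∀ n, lam n ≠ l → a n = 0) →
      (∀ i, ∑ n, a n * C n i = 0) → a = 0) (m : Fin N) :
    ∃ v : Fin M → ℝ → ℂ, (∀ i, ContDiff ℝ 2 (v i)) ∧ (∀ i t, T ≤ t → v i t = 0) ∧
      ∀ n, (∫ s in (0 : ℝ)..T, (modeP (lam n) δ (-s) : ℂ) * ∑ i, C n i * v i s
          = if n = m then -1 else 0) ∧
        ∫ s in (0 : ℝ)..T, (modeZ (lam n) δ (-s) : ℂ) * ∑ i, C n i * v i s = 0 := by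
  obtain ⟨v, hv, hvT, hm⟩ := exists_moments (ι := Fin N ⊕ Fin N) (κ := Fin M) hT
    (fun k i s => Sum.elim (fun n => C n i * modeP (lam n) δ (-s))
      (fun n => C n i * modeZ (lam n) δ (-s)) k)
    (by
      rintro (n | n) i
      · exact contDiff_const.mul
          (Complex.ofRealCLM.contDiff.comp ((contDiff_modeP _ _).comp contDiff_neg))
      · exact contDiff_const.mul
          (Complex.ofRealCLM.contDiff.comp ((contDiff_modeZ _ _).comp contDiff_neg)))
    (by
      intro a ha
      have := eq_zero_of_modes_eq_zero hδ hT hC (x := fun n => (a (Sum.inl n), a (Sum.inr n)))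
        (fun i s hs => by
          rw [← ha i s hs, Fintype.sum_sum_type, ← Finset.sum_add_distrib]
          refine Finset.sum_congr rfl fun n _ => ?_
          simp only [Sum.elim_inl, Sum.elim_inr]
          ring)
      funext k
      rcases k with n | n
      · exact congrArg Prod.fst (congrFun this n)
      · exact congrArg Prod.snd (congrFun this n))
    (Sum.elim (fun n => if n = m then -1 else 0) fun _ => 0)
  refine ⟨v, hv, hvT, fun n => ⟨?_, ?_⟩⟩
  · rw [← Sum.elim_inl (fun n => if n = m then (-1 : ℂ) else 0) (fun _ => 0) n, ← hm]
    congr 1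
    funext s
    rw [Finset.mul_sum]
    exact Finset.sum_congr rfl fun i _ => by simp only [Sum.elim_inl]; ring
  · refine Eq.trans ?_ (hm (Sum.inr n))
    congr 1
    funext s
    rw [Finset.mul_sum]
    exact Finset.sum_congr rfl fun i _ => by simp only [Sum.elim_inr]; ring

/-! ### The characteristic roots -/

theorem csqrt_sq (x : ℝ) : csqrt x ^ 2 = x := by
  have h : (Real.sqrt x : ℂ) * Real.sqrt (-x) = 0 := by
    rcases le_total 0 x with h | h
    · simp [Real.sqrt_eq_zero_of_nonpos (neg_nonpos.2 h)]
    · simp [Real.sqrt_eq_zero_of_nonpos h]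
  have h2 : (Real.sqrt x : ℂ) ^ 2 - (Real.sqrt (-x) : ℂ) ^ 2 = x := by
    rw [← Complex.ofReal_pow, ← Complex.ofReal_pow, ← Complex.ofReal_sub]
    congr 1
    rcases le_total 0 x with h | h
    · rw [Real.sq_sqrt h, Real.sqrt_eq_zero_of_nonpos (neg_nonpos.2 h)]; simp
    · rw [Real.sq_sqrt (neg_nonneg.2 h), Real.sqrt_eq_zero_of_nonpos h]; simp
  rw [csqrt]
  linear_combination h2 + 2 * Complex.I * h + (Real.sqrt (-x) : ℂ) ^ 2 * Complex.I_sq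

theorem muPlus_add_muMinus (δ l : ℝ) : muPlus δ l + muMinus δ l = l + δ := by
  rw [muPlus, muMinus]
  push_cast
  ring

theorem muPlus_mul_muMinus (δ l : ℝ) : muPlus δ l * muMinus δ l = l * (1 + δ) := by
  have := csqrt_sq ((l - δ) ^ 2 - 4 * l)
  rw [muPlus, muMinus]
  push_cast at this ⊢
  linear_combination -this / 4

theorem muPlus_root (δ l : ℝ) : muPlus δ l ^ 2 - (l + δ) * muPlus δ l + l * (1 + δ) = 0 := by
  rw [← muPlus_add_muMinus, ← muPlus_mul_muMinus]
  ring

theorem muMinus_root (δ l : ℝ) : muMinus δ l ^ 2 - (l + δ) * muMinus δ l + l * (1 + δ) = 0 := by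
  rw [← muPlus_add_muMinus, ← muPlus_mul_muMinus]
  ring

/-- A characteristic root determines the eigenvalue it comes from. -/
theorem eq_of_common_root {δ l l' : ℝ} (hδ : 0 < δ) {μ : ℂ}
    (h : μ ^ 2 - (l + δ) * μ + l * (1 + δ) = 0) (h' : μ ^ 2 - (l' + δ) * μ + l' * (1 + δ) = 0) :
    l = l' := by
  have h1 : ((l : ℂ) - l') * (1 + δ - μ) = 0 := by linear_combination h - h'
  rcases mul_eq_zero.1 h1 with h2 | h2
  · exact_mod_cast sub_eq_zero.1 h2
  · have h3 : μ = 1 + δ := by linear_combination -h2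
    rw [h3] at h
    have : (1 + δ : ℂ) = 0 := by linear_combination h
    have : (1 + δ : ℝ) = 0 := by exact_mod_cast this
    linarith

/-! ### Consequences of the rank conditions -/

theorem eigList_root (lam : ℕ → ℝ) (δ : ℝ) (N : ℕ) (k : Fin N ⊕ Fin N) :
    eigList lam δ N k ^ 2 + (Sum.elim (fun j : Fin N => lam j) (fun j : Fin N => lam j) k + δ)
      * eigList lam δ N k
      + Sum.elim (fun j : Fin N => lam j) (fun j : Fin N => lam j) k * (1 + δ) = 0 := by
  rcases k with j | j
  · simp only [eigList, Sum.elim_inl]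
    linear_combination muPlus_root δ (lam j)
  · simp only [eigList, Sum.elim_inr]
    linear_combination muMinus_root δ (lam j)

theorem mul_matP_inl (lam : ℕ → ℝ) (δ : ℝ) {N : ℕ} (R : Matrix (Fin N ⊕ Fin N) (Fin N ⊕ Fin N) ℂ)
    (k : Fin N ⊕ Fin N) (n : Fin N) :
    (R * matP lam δ N) k (Sum.inl n) = -(R k (Sum.inr n) * (lam n * (1 + δ))) := by
  simp [Matrix.mul_apply, matP, Fintype.sum_sum_type, Matrix.fromBlocks, Matrix.diagonal_apply]

theorem mul_matP_inr (lam : ℕ → ℝ) (δ : ℝ) {N : ℕ} (R : Matrix (Fin N ⊕ Fin N) (Fin N ⊕ Fin N) ℂ)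
    (k : Fin N ⊕ Fin N) (n : Fin N) :
    (R * matP lam δ N) k (Sum.inr n) = R k (Sum.inl n) - R k (Sum.inr n) * (lam n + δ) := by
  simp [Matrix.mul_apply, matP, Fintype.sum_sum_type, Matrix.fromBlocks, Matrix.diagonal_apply,
    Matrix.one_apply, sub_eq_add_neg]
  ring

/-- The rows of a matrix that brings `P` to Jordan form are supported in the groups of the
eigenvalues. -/
theorem row_supported {lam : ℕ → ℝ} {δ : ℝ} (hδ : 0 < δ) {N : ℕ}
    {R J : Matrix (Fin N ⊕ Fin N) (Fin N ⊕ Fin N) ℂ} (hRJ : R * matP lam δ N = J * R)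
    (hJd : ∀ k, J k k = eigList lam δ N k) (e : Fin N ⊕ Fin N → ℕ) {m : ℕ} (he : ∀ k, e k < m)
    (hJ : ∀ k k', k ≠ k' → J k k' ≠ 0 → e k < e k' ∧ J k k = J k' k')
    (k : Fin N ⊕ Fin N) (n : Fin N)
    (hn : lam n ≠ Sum.elim (fun j : Fin N => lam j) (fun j : Fin N => lam j) k) :
    R k (Sum.inl n) = 0 ∧ R k (Sum.inr n) = 0 := by
  -- The induction descends along the Jordan ordering `e`: an off-diagonal entry of row `k` of `J`
  -- leads to a later coordinate with the same diagonal value, hence the same eigenvalue of `A`,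
  -- where the entries of `R` already vanish. Row `k` of `R` then behaves, in the two columns of
  -- `n`, like a left eigenvector of `P`.
  induction hr : m - e k using Nat.strong_induction_on generalizing k with
  | _ r ih =>
    have hJR : ∀ c, (c = Sum.inl n ∨ c = Sum.inr n) →
        (J * R) k c = eigList lam δ N k * R k c := by
      intro c hc
      rw [Matrix.mul_apply, Finset.sum_eq_single k, hJd]
      · intro k' _ hk'
        by_cases h0 : J k k' = 0
        · rw [h0, zero_mul]
        · obtain ⟨h1, h2⟩ := hJ k k' hk'.symm h0
          rw [hJd, hJd] at h2
          have h3 := eigList_root lam δ N k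
          have h4 := eigList_root lam δ N k'
          rw [← h2] at h4
          have h5 := eq_of_common_root (l := Sum.elim (fun j : Fin N => lam j) (fun j : Fin N => lam j) k)
            (l' := Sum.elim (fun j : Fin N => lam j) (fun j : Fin N => lam j) k') hδ
            (μ := -eigList lam δ N k) (by linear_combination h3) (by linear_combination h4)
          have := ih (m - e k') (by have := he k'; omega) k' (by rwa [← h5]) rfl
          rcases hc with rfl | rfl
          · rw [this.1, mul_zero]
          · rw [this.2, mul_zero]
      · simp
    have h1 := hJR _ (Or.inl rfl)
    have h2 := hJR _ (Or.inr rfl)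
    rw [← hRJ, mul_matP_inl] at h1
    rw [← hRJ, mul_matP_inr] at h2
    have h3 : R k (Sum.inr n) = 0 := by
      have h4 : R k (Sum.inr n) * (eigList lam δ N k ^ 2 + (lam n + δ) * eigList lam δ N k
          + lam n * (1 + δ)) = 0 := by
        -- Eliminating the entry in the first half leaves the characteristic polynomial of mode `n`
        -- at the root attached to `k`; by `eq_of_common_root` it is nonzero across groups.
        linear_combination -h1 - eigList lam δ N k * h2
      refine (mul_eq_zero.1 h4).resolve_right fun h5 => hn ?_
      exact eq_of_common_root hδ (μ := -eigList lam δ N k)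
            (by linear_combination h5) (by linear_combination eigList_root lam δ N k)
    refine ⟨?_, h3⟩
    rw [h3] at h2
    simpa using h2

open scoped ComplexOrder in
/-- If a matrix with rows supported in the groups of the eigenvalues transforms `(0; C)` into a
matrix satisfying the block rank condition, the rows of `C` in each group are independent. -/
theorem rows_independent_of_blockRank {lam : ℕ → ℝ} {N M : ℕ}
    {R : Matrix (Fin N ⊕ Fin N) (Fin N ⊕ Fin N) ℂ} {C : Fin N → Fin M → ℂ} {Q : Matrix (Fin N ⊕ Fin N) (Fin M) ℂ}
    (hQ0 : ∀ n i, Q (Sum.inl n) i = 0) (hQC : ∀ n i, Q (Sum.inr n) i = C n i)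
    (hR : ∀ j n : Fin N, lam n ≠ lam j → R (Sum.inl j) (Sum.inr n) = 0)
    (hrank : BlockRank lam (R * Q)) (l : ℝ) (a : Fin N → ℂ)
    (hal : ∀ n : Fin N, lam n ≠ l → a n = 0) (ha : ∀ i, ∑ n, a n * C n i = 0) : a = 0 := by
  by_contra hne
  obtain ⟨j, hj⟩ := Function.ne_iff.1 hne
  have hjl : lam j = l := by
    by_contra h
    exact hj (hal j h)
  subst hjl
  let G := {i : Fin N // lam i = lam j}
  let R' : Matrix G G ℂ := Matrix.of fun g g' => R (Sum.inl g.1) (Sum.inr g'.1)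
  let C' : Matrix G (Fin M) ℂ := Matrix.of fun g i => C g.1 i
  have hsum : ∀ F : Fin N → ℂ, (∀ n : Fin N, lam n ≠ lam j → F n = 0) →
      ∑ n, F n = ∑ g : G, F g.1 := by
    intro F hF
    rw [← Fintype.sum_subtype_add_sum_subtype (fun n : Fin N => lam n = lam j) F,
      Fintype.sum_eq_zero (fun n : {n : Fin N // ¬lam n = lam j} => F n) fun n => hF n n.2,
      add_zero]
  -- The support of the rows of `R` restricts the sum to one group, so the block of `R * Q` factors
  -- through the block of `C`, whose rank is therefore full.
  have hprod : (R * Q).submatrix (fun g : G => Sum.inl g.1) id = R' * C' := by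
    ext g i
    rw [Matrix.submatrix_apply, Matrix.mul_apply, Matrix.mul_apply, Fintype.sum_sum_type]
    simp only [hQ0, hQC, mul_zero,
      Finset.sum_const_zero, zero_add, id]
    rw [hsum]
    · rfl
    · intro n hn
      rw [hR g.1 n (by rwa [g.2]), zero_mul]
  have hC' : Fintype.card G ≤ C'.rank := by
    have h1 : (R' * C').conjTranspose.rank = multiplicity lam N j := by
      rw [← hprod]
      exact (hrank j).1
    rw [Matrix.rank_conjTranspose] at h1
    rw [← show multiplicity lam N j = Fintype.card G from rfl, ← h1]
    exact Matrix.rank_mul_le_right _ _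
  have hli : LinearIndependent ℂ C'.row := by
    rw [linearIndependent_iff_card_le_finrank_span]
    rwa [Matrix.rank_eq_finrank_span_row] at hC'
  have := Fintype.linearIndependent_iff.1 hli (fun g => a g.1) (by
    funext i
    rw [Finset.sum_apply]
    have h1 := ha i
    rw [hsum (fun n => a n * C n i) (fun n hn => by simp only [hal n hn, zero_mul])] at h1
    exact h1) ⟨j, rfl⟩
  exact hj this

theorem rows_independent {H : Type*} [NormedAddCommGroup H] [InnerProductSpace ℝ H]
    {B : H →L[ℝ] H} {φ : ℕ → H} {lam : ℕ → ℝ} {δ : ℝ} (hδ : 0 < δ) {N M : ℕ}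
    {Φ : Fin M → Complexification H}
    (h : SemisimpleRankCondition B φ lam δ N Φ ∨ JordanRankCondition B φ lam δ N Φ)
    (l : ℝ) (a : Fin N → ℂ) (hal : ∀ n : Fin N, lam n ≠ l → a n = 0)
    (ha : ∀ i, ∑ n : Fin N, a n * inner ℂ (Complexification.ofReal (φ n))
      (Complexification.mapL B (Φ i)) = 0) : a = 0 := by
  obtain ⟨R, J, e, m, hR, hP, hJd, he, hJ, hrank⟩ :
      ∃ (R J : Matrix (Fin N ⊕ Fin N) (Fin N ⊕ Fin N) ℂ) (e : Fin N ⊕ Fin N → ℕ) (m : ℕ),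
        IsUnit R ∧ matP lam δ N = R⁻¹ * J * R ∧ (∀ k, J k k = eigList lam δ N k) ∧
        (∀ k, e k < m) ∧ (∀ k k', k ≠ k' → J k k' ≠ 0 → e k < e k' ∧ J k k = J k' k') ∧
        BlockRank lam (R * matQ B φ N Φ) := by
    rcases h with ⟨R, hR, hP, hrank⟩ | ⟨R, J, hR, ⟨hJd, m, e, hJ1, hJ2⟩, hP, hrank⟩
    -- A diagonal matrix has no off-diagonal links, so any bounded ordering function will do.
    · exact ⟨R, _, fun _ => 0, 1, hR, hP, fun k => Matrix.diagonal_apply_eq _ _, fun _ => one_pos,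
        fun k k' hk h0 => absurd (Matrix.diagonal_apply_ne _ hk) h0, hrank⟩
    · refine ⟨R, J, fun k => e k, m, hR, hP, hJd, fun k => (e k).2, fun k k' hk h0 => ?_, hrank⟩
      by_cases hs : (e k : ℕ) + 1 = e k'
      · rcases hJ2 (e k) (e k') hs with h1 | h1
        · exact absurd (by simpa using h1) h0
        · exact ⟨by simp only; omega, by simpa using h1.2⟩
      · have := hJ1 (e k) (e k') (fun h => hk (e.injective h)) hs
        exact absurd (by simpa using this) h0
  have hRJ : R * matP lam δ N = J * R := by
    have hdet : IsUnit R.det := (Matrix.isUnit_iff_isUnit_det R).1 hR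
    rw [hP, ← Matrix.mul_assoc, ← Matrix.mul_assoc, Matrix.mul_nonsing_inv _ hdet, Matrix.one_mul]
  exact rows_independent_of_blockRank
    (fun _ _ => rfl) (fun _ _ => rfl) (fun j n hn => (row_supported hδ hRJ hJd e he hJ (Sum.inl j) n hn).2) hrank l a hal ha

/-! ### Decay of the stable modes -/

theorem csqrt_re (x : ℝ) : (csqrt x).re = Real.sqrt x := by simp [csqrt]

theorem muPlus_re (δ l : ℝ) :
    (muPlus δ l).re = (l + δ + Real.sqrt ((l - δ) ^ 2 - 4 * l)) / 2 := by
  rw [muPlus, show (2 : ℂ) = ((2 : ℝ) : ℂ) by norm_num, Complex.div_ofReal_re, Complex.add_re,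
    csqrt_re, Complex.ofReal_re]

theorem muMinus_re (δ l : ℝ) :
    (muMinus δ l).re = (l + δ - Real.sqrt ((l - δ) ^ 2 - 4 * l)) / 2 := by
  rw [muMinus, show (2 : ℂ) = ((2 : ℝ) : ℂ) by norm_num, Complex.div_ofReal_re, Complex.sub_re,
    csqrt_re, Complex.ofReal_re]

theorem muMinus_re_le (δ l : ℝ) : (muMinus δ l).re ≤ (muPlus δ l).re := by
  rw [muMinus_re, muPlus_re]
  have := Real.sqrt_nonneg ((l - δ) ^ 2 - 4 * l)
  linarith

theorem norm_cexp_mul_ofReal (μ : ℂ) (t : ℝ) : ‖Complex.exp (μ * t)‖ = Real.exp (μ.re * t) := by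
  rw [Complex.norm_exp]
  simp

/-- The combination q = p + (μ⁻-1-δ)z is a left eigenvector: q' = -μ⁺q, while z' = q - μ⁻z. This
triangular form needs no distinction between simple and double roots. A factor t may appear in z,
and it is absorbed by the gap Re μ⁻ - γ. -/
theorem modeY_decay {l δ γ : ℝ} (h : γ < (muMinus δ l).re) :
    ∃ K : ℝ, 0 ≤ K ∧ ∀ t, 0 ≤ t → |modeY l δ t| ≤ K * Real.exp (-(γ * t)) := by
  set μ := muMinus δ l with hμ
  set μ' := muPlus δ l with hμ'
  have hsum : μ' + μ = l + δ := muPlus_add_muMinus δ l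
  have hprod : μ' * μ = l * (1 + δ) := muPlus_mul_muMinus δ l
  have hle : μ.re ≤ μ'.re := muMinus_re_le δ l
  set r := μ.re with hr
  set q : ℝ → ℂ := fun t => modeP l δ t + (μ - 1 - δ) * modeZ l δ t with hq
  have hP := fun t => (hasDerivAt_modeP l δ t).ofReal_comp
  have hZ := fun t => (hasDerivAt_modeZ l δ t).ofReal_comp
  have hqd : ∀ t : ℝ, HasDerivAt q (-μ' * q t) t := by
    intro t
    refine ((hP t).add ((hZ t).const_mul (μ - 1 - δ))).congr_deriv ?_
    simp only [hq]
    push_cast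
    linear_combination (modeP l δ t - (1 + δ) * modeZ l δ t : ℂ) * hsum
      + (modeZ l δ t : ℂ) * hprod
  have hq1 : ∀ t : ℝ, Complex.exp (μ' * t) * q t = 1 := by
    have hd : ∀ t : ℝ, HasDerivAt (fun t : ℝ => Complex.exp (μ' * t) * q t) 0 t := fun t =>
      ((hasDerivAt_cexp_mul μ' t).mul (hqd t)).congr_deriv (by ring)
    intro t
    have := is_const_of_deriv_eq_zero (fun t => (hd t).differentiableAt) (fun t => (hd t).deriv) t 0
    simpa [hq] using this
  have hqn : ∀ t : ℝ, ‖q t‖ = Real.exp (-(μ'.re * t)) := by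
    intro t
    have := congrArg norm (hq1 t)
    rw [norm_mul, norm_cexp_mul_ofReal, norm_one] at this
    rw [Real.exp_neg]
    exact eq_inv_of_mul_eq_one_right this
  have hz : ∀ t, 0 ≤ t → |modeZ l δ t| ≤ t * Real.exp (-(r * t)) := by
    intro t ht
    have hd : ∀ s : ℝ, HasDerivAt (fun s : ℝ => Complex.exp (μ * s) * modeZ l δ s)
        (Complex.exp (μ * s) * q s) s := fun s =>
      ((hasDerivAt_cexp_mul μ s).mul (hZ s)).congr_deriv (by
        simp only [hq]
        push_cast
        ring)
    have := norm_image_sub_le_of_norm_deriv_le_segment' (C := 1)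
      (fun s _ => (hd s).hasDerivWithinAt) (fun s (hs : s ∈ Ico 0 t) => by
        rw [norm_mul, norm_cexp_mul_ofReal, hqn, ← Real.exp_add]
        refine Real.exp_le_one_iff.2 ?_
        have := mul_le_mul_of_nonneg_right hle hs.1
        linarith) t ⟨ht, le_rfl⟩
    simp only [modeZ_zero, Complex.ofReal_zero, mul_zero, sub_zero, one_mul, norm_mul,
      norm_cexp_mul_ofReal, Complex.norm_real, Real.norm_eq_abs] at this
    rw [Real.exp_neg, ← div_eq_mul_inv, le_div_iff₀ (Real.exp_pos _), mul_comm]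
    exact this
  refine ⟨1 + ‖μ - δ‖ * (1 / (r - γ)), by have := sub_pos.2 h; positivity, fun t ht => ?_⟩
  have hrγ : 0 < r - γ := sub_pos.2 h
  have hE : ((modeY l δ t : ℝ) : ℂ) = q t - (μ - δ) * modeZ l δ t := by
    simp only [hq, modeY]
    push_cast
    ring
  have h1 : ‖q t‖ ≤ Real.exp (-(γ * t)) := by
    rw [hqn]
    refine Real.exp_le_exp.2 (neg_le_neg (mul_le_mul_of_nonneg_right ?_ ht))
    linarith
  have h2 : |modeZ l δ t| ≤ 1 / (r - γ) * Real.exp (-(γ * t)) := by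
    refine (hz t ht).trans ?_
    have h3 : (r - γ) * t ≤ Real.exp ((r - γ) * t) := by
      linarith [Real.add_one_le_exp ((r - γ) * t)]
    have h4 : Real.exp (-(γ * t)) = Real.exp ((r - γ) * t) * Real.exp (-(r * t)) := by
      rw [← Real.exp_add]
      ring_nf
    rw [h4, ← mul_assoc]
    refine mul_le_mul_of_nonneg_right ?_ (Real.exp_pos _).le
    rw [one_div, ← div_eq_inv_mul, le_div_iff₀ hrγ, mul_comm]
    exact h3
  calc |modeY l δ t| = ‖((modeY l δ t : ℝ) : ℂ)‖ := by rw [Complex.norm_real, Real.norm_eq_abs]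
    _ ≤ ‖q t‖ + ‖μ - δ‖ * |modeZ l δ t| := by
        rw [hE]
        refine (norm_sub_le _ _).trans_eq ?_
        rw [norm_mul, Complex.norm_real, Real.norm_eq_abs]
    _ ≤ Real.exp (-(γ * t)) + ‖μ - δ‖ * (1 / (r - γ) * Real.exp (-(γ * t))) := by gcongr
    _ = _ := by ring

theorem exists_lt_muMinus_re {δ γ : ℝ} (hδ : 0 < δ) (hγ : 0 < γ) (hγδ : γ < δ + 1) :
    ∃ L : ℝ, ∀ l, L ≤ l → γ < (muMinus δ l).re := by
  have hpos : 0 < 1 + δ - γ := by linarith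
  -- The claim reads √((l-δ)²-4l) < l+δ-2γ. The term 2γ makes the right side positive; after
  -- squaring, l(1+δ-γ) + γ² > γδ is left, which the second term ensures.
  refine ⟨2 * γ + γ * δ / (1 + δ - γ), fun l hl => ?_⟩
  have h0 : 0 ≤ γ * δ / (1 + δ - γ) := by positivity
  have h1 : γ * δ ≤ l * (1 + δ - γ) := by
    rw [← div_le_iff₀ hpos]
    linarith
  rw [muMinus_re]
  have h2 : Real.sqrt ((l - δ) ^ 2 - 4 * l) < l + δ - 2 * γ := by
    rw [Real.sqrt_lt' (by linarith)]
    nlinarith [mul_pos hγ hγ]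
  linarith

/-- The eigenvalues of an operator with compact resolvent are unbounded. -/
theorem exists_le_eigenvalue {H : Type*} [NormedAddCommGroup H] [InnerProductSpace ℝ H]
    {A : H →ₗ.[ℝ] H} (hA : HasCompactResolvent A) {φ : ℕ → H} (hφo : Orthonormal ℝ φ)
    {lam : ℕ → ℝ} (hpos : ∀ n, 0 ≤ lam n)
    (hφ : ∀ n, ∃ h : φ n ∈ A.domain, A ⟨φ n, h⟩ = lam n • φ n) (L : ℝ) : ∃ n, L ≤ lam n := by
  by_contra! hL
  obtain ⟨r, K, hK, -, hK2⟩ := hA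
  have hKφ : ∀ n, (r - lam n) • K (φ n) = φ n := by
    intro n
    obtain ⟨h, hn⟩ := hφ n
    have := hK2 ⟨φ n, h⟩
    rw [hn, ← sub_smul, map_smul] at this
    exact this
  -- If the eigenvalues stayed below `L`, the vectors `K (φ n)` would be orthogonal with norms
  -- bounded away from 0, and no subsequence could converge.
  have hlow : ∀ n, 1 ≤ (|r| + L) * ‖K (φ n)‖ := by
    intro n
    have h1 := congrArg norm (hKφ n)
    rw [norm_smul, hφo.1 n, Real.norm_eq_abs] at h1
    rw [← h1]
    refine mul_le_mul_of_nonneg_right ((abs_sub _ _).trans ?_) (norm_nonneg _)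
    rw [abs_of_nonneg (hpos n)]
    linarith [hL n]
  have horth : ∀ n m, n ≠ m → inner ℝ (K (φ n)) (K (φ m)) = 0 := by
    intro n m hnm
    have h1 : inner ℝ ((r - lam n) • K (φ n)) ((r - lam m) • K (φ m)) = 0 := by
      rw [hKφ, hKφ]
      exact hφo.2 hnm
    rw [inner_smul_left, inner_smul_right, ← mul_assoc] at h1
    refine (mul_eq_zero.1 h1).resolve_left ?_
    have hne : ∀ n, r - lam n ≠ 0 := fun n h => by
      have := hKφ n
      rw [h, zero_smul] at this
      exact hφo.ne_zero n this.symm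
    exact mul_ne_zero (by simpa using hne n) (hne m)
  have hcpt := hK.isCompact_closure_image_closedBall (f := (K : H →ₗ[ℝ] H)) 1
  obtain ⟨y, -, ψ, hψ, hy⟩ := hcpt.tendsto_subseq (x := fun n => K (φ n)) fun n =>
    subset_closure ⟨φ n, by simp [hφo.1 n], rfl⟩
  have hy2 : Tendsto (fun n => K (φ (ψ (n + 1)))) atTop (𝓝 y) :=
    hy.comp (tendsto_add_atTop_nat 1)
  -- The subsequence is paired with its own shift; distinct indices make every inner product zero.
  have h0 : inner ℝ y y = 0 := by
    refine tendsto_nhds_unique (hy.inner hy2) ?_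
    refine tendsto_const_nhds.congr fun n => (horth _ _ (hψ (Nat.lt_succ_self n)).ne).symm
  have hy0 : y = 0 := inner_self_eq_zero.1 h0
  have h1 : (1 : ℝ) ≤ (|r| + L) * ‖y‖ :=
    ge_of_tendsto' (hy.norm.const_mul (|r| + L)) fun n => hlow _
  rw [hy0, norm_zero, mul_zero] at h1
  linarith

theorem lt_muMinus_re_of_unstableDim_le {lam : ℕ → ℝ} (hlam : Monotone lam)
    (hunb : ∀ L, ∃ n, L ≤ lam n) {δ γ : ℝ} (hδ : 0 < δ) (hγ : 0 < γ) (hγδ : γ < δ + 1) {n : ℕ}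
    (hn : unstableDim lam δ γ ≤ n) : γ < (muMinus δ (lam n)).re := by
  by_contra! hle
  obtain ⟨L, hL⟩ := exists_lt_muMinus_re hδ hγ hγδ
  obtain ⟨m, hm⟩ := hunb L
  have hbdd : BddAbove {n : ℕ | ∃ j : ℕ, n = j + 1 ∧ (muMinus δ (lam j)).re ≤ γ} := by
    refine ⟨m, ?_⟩
    rintro _ ⟨j, rfl, hj⟩
    by_contra! hlt
    exact absurd hj (not_le.2 (hL _ (hm.trans (hlam (by omega)))))
  -- Eigenvalues are numbered from 0 while `unstableDim` counts from 1. Boundedness above is needed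
  -- because the supremum of an unbounded set of naturals is 0 by convention.
  have h1 : n + 1 ≤ unstableDim lam δ γ := (le_csSup hbdd ⟨n, rfl, hle⟩).trans (le_max_right _ _)
  omega

/-- Uniform decay of the stable modes. -/
theorem exists_modeY_decay {lam : ℕ → ℝ} (hlam : Monotone lam)
    (hunb : ∀ L, ∃ n, L ≤ lam n) {δ γ : ℝ} (hδ : 0 < δ) (hγ : 0 < γ) (hγδ : γ < δ + 1) :
    ∃ K : ℝ, 0 ≤ K ∧ ∀ n, unstableDim lam δ γ ≤ n → ∀ t, 0 ≤ t →
      |modeY (lam n) δ t| ≤ K * Real.exp (-(γ * t)) := by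
  have h1 : ∀ n, ∃ K : ℝ, 0 ≤ K ∧ (unstableDim lam δ γ ≤ n → ∀ t, 0 ≤ t →
      |modeY (lam n) δ t| ≤ K * Real.exp (-(γ * t))) := by
    intro n
    by_cases hn : unstableDim lam δ γ ≤ n
    · obtain ⟨K, hK0, hK⟩ := modeY_decay (lt_muMinus_re_of_unstableDim_le hlam hunb hδ hγ hγδ hn)
      exact ⟨K, hK0, fun _ => hK⟩
    · exact ⟨0, le_rfl, fun h => absurd h hn⟩
  choose K hK0 hK using h1
  -- From 2+δ on, both dissipation rates in the energy bound are at least 1+δ > γ, with constant 2;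
  -- only finitely many modes need individual constants.
  obtain ⟨m, hm⟩ := hunb (2 + δ)
  have hs : 0 ≤ ∑ n ∈ Finset.range m, K n := Finset.sum_nonneg fun n _ => hK0 n
  refine ⟨2 + ∑ n ∈ Finset.range m, K n, by linarith, fun n hn t ht => ?_⟩
  by_cases hnm : n < m
  · refine (hK n hn t ht).trans (mul_le_mul_of_nonneg_right ?_ (Real.exp_pos _).le)
    have := Finset.single_le_sum (fun n _ => hK0 n) (Finset.mem_range.2 hnm)
    linarith
  · have hl : 2 + δ ≤ lam n := hm.trans (hlam (by omega))
    refine (abs_modeY_le (κ := -(1 + δ)) hδ.le (by linarith) le_rfl ht).trans ?_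
    refine mul_le_mul (by linarith) (Real.exp_le_exp.2 ?_) (Real.exp_pos _).le (by linarith)
    rw [neg_mul]
    exact neg_le_neg (mul_le_mul_of_nonneg_right (by linarith) ht)

end PIDE

/-! ### Orthonormal bases of the complexification -/

namespace Complexification

variable {H : Type*} [NormedAddCommGroup H] [InnerProductSpace ℝ H]

theorem inner_ofReal_left (x : H) (z : Complexification H) :
    inner ℂ (ofReal x) z = (⟨inner ℝ x z.re, inner ℝ x z.im⟩ : ℂ) := by
  change (⟨inner ℝ x z.re + inner ℝ (0 : H) z.im, inner ℝ x z.im - inner ℝ (0 : H) z.re⟩ : ℂ) = _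
  simp

/-- The real orthonormal basis, as a basis of the complexification. -/
theorem exists_hilbertBasis [CompleteSpace H] (φ : HilbertBasis ℕ ℝ H) :
    ∃ b : HilbertBasis ℕ ℂ (Complexification H), ∀ n, b n = ofReal (φ n) := by
  have ho : Orthonormal ℂ fun n => ofReal (φ n) := by
    rw [orthonormal_iff_ite]
    intro i j
    rw [inner_ofReal_left]
    have h1 := orthonormal_iff_ite.1 φ.orthonormal i j
    simp only [ofReal, re_mk, im_mk, h1, inner_zero_right]
    split_ifs <;> rfl
  have hsp : (Submodule.span ℂ (Set.range fun n => ofReal (φ n)))ᗮ = ⊥ := by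
    rw [Submodule.eq_bot_iff]
    intro z hz
    have h1 : ∀ n, inner ℂ (ofReal (φ n)) z = 0 := fun n =>
      (Submodule.mem_orthogonal _ _).1 hz _ (Submodule.subset_span ⟨n, rfl⟩)
    have h2 : ∀ x : H, (∀ n, inner ℝ (φ n) x = 0) → x = 0 := by
      intro x hx
      apply φ.repr.injective
      ext n
      rw [φ.repr_apply_apply, hx, map_zero]
      rfl
    refine ext' (h2 _ fun n => ?_) (h2 _ fun n => ?_)
    · have := h1 n
      rw [inner_ofReal_left] at this
      exact congrArg Complex.re this
    · have := h1 n
      rw [inner_ofReal_left] at this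
      exact congrArg Complex.im this
  exact ⟨HilbertBasis.mkOfOrthogonalEqBot ho hsp, fun n =>
    congrFun (HilbertBasis.coe_mkOfOrthogonalEqBot ho hsp) n⟩

end Complexification

namespace PIDE

open Set Filter Topology MeasureTheory

/-! ### Diagonal operators -/

section Diagonal

variable {E : Type*} [NormedAddCommGroup E] [InnerProductSpace ℂ E]

theorem hilbertBasis_ext (b : HilbertBasis ℕ ℂ E) {x y : E}
    (h : ∀ n, inner ℂ (b n) x = inner ℂ (b n) y) : x = y := by
  apply b.repr.injective
  ext n
  rw [b.repr_apply_apply, b.repr_apply_apply, h]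

theorem exists_diagonal (b : HilbertBasis ℕ ℂ E) {d : ℕ → ℂ} {K : ℝ} (hK : ∀ n, ‖d n‖ ≤ K) :
    ∃ T : E →L[ℂ] E, (∀ x, ‖T x‖ ≤ K * ‖x‖) ∧
      ∀ x n, inner ℂ (b n) (T x) = d n * inner ℂ (b n) x := by
  have hK0 : 0 ≤ K := (norm_nonneg _).trans (hK 0)
  have h2 : (0 : ℝ) < (2 : ENNReal).toReal := by norm_num
  have hle : ∀ (x : E) (n : ℕ), ‖d n * b.repr x n‖ ^ (2 : ENNReal).toReal
      ≤ K ^ (2 : ENNReal).toReal * ‖b.repr x n‖ ^ (2 : ENNReal).toReal := by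
    intro x n
    rw [← Real.mul_rpow hK0 (norm_nonneg _), norm_mul]
    exact Real.rpow_le_rpow (by positivity)
      (mul_le_mul_of_nonneg_right (hK n) (norm_nonneg _)) h2.le
  have hsum : ∀ x : E, Summable fun n => ‖b.repr x n‖ ^ (2 : ENNReal).toReal := fun x =>
    (lp.memℓp (b.repr x)).summable h2
  have hmem : ∀ x : E, Memℓp (fun n => d n * b.repr x n) 2 := fun x =>
    (memℓp_gen_iff h2).2 (Summable.of_nonneg_of_le (fun n => by positivity) (hle x)
      ((hsum x).mul_left _))
  let T : E →ₗ[ℂ] E :=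
    { toFun := fun x => b.repr.symm ⟨fun n => d n * b.repr x n, hmem x⟩
      map_add' := fun x y => by
        rw [← map_add]
        congr 1
        ext n
        simp only [map_add, lp.coeFn_add, Pi.add_apply, mul_add]
      map_smul' := fun c x => by
        rw [← map_smul]
        congr 1
        ext n
        simp [mul_left_comm] }
  have hT : ∀ x, ‖T x‖ ≤ K * ‖x‖ := by
    intro x
    simp only [T, LinearMap.coe_mk, AddHom.coe_mk, LinearIsometryEquiv.norm_map]
    refine lp.norm_le_of_tsum_le h2 (by positivity) ?_
    rw [Real.mul_rpow hK0 (norm_nonneg _), ← b.repr.norm_map x, lp.norm_rpow_eq_tsum h2,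
      ← tsum_mul_left]
    exact Summable.tsum_le_tsum (hle x) ((memℓp_gen_iff h2).1 (hmem x)) ((hsum x).mul_left _)
  refine ⟨T.mkContinuous K hT, hT, fun x n => ?_⟩
  rw [← b.repr_apply_apply, ← b.repr_apply_apply]
  simp [T]

/-- Strong continuity of a family of diagonal operators. -/
theorem continuous_diagonal_apply (b : HilbertBasis ℕ ℂ E) {S : ℝ → E →L[ℂ] E} {d : ℝ → ℕ → ℂ}
    (hS : ∀ t x n, inner ℂ (b n) (S t x) = d t n * inner ℂ (b n) x)
    (hd : ∀ n, Continuous fun t => d t n) {κ : ℝ → ℝ} (hκ : Continuous κ)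
    (hb : ∀ t x, ‖S t x‖ ≤ κ t * ‖x‖) (x : E) : Continuous fun t => S t x := by
  have hspan : ∀ y ∈ Submodule.span ℂ (range b), Continuous fun t => S t y := by
    intro y hy
    induction hy using Submodule.span_induction with
    | mem y hy =>
      obtain ⟨n, rfl⟩ := hy
      have : (fun t => S t (b n)) = fun t => d t n • b n := by
        funext t
        refine hilbertBasis_ext b fun m => ?_
        rw [hS, inner_smul_right]
        by_cases h : m = n
        · rw [h]
        · rw [b.orthonormal.2 h, mul_zero, mul_zero]
      rw [this]
      exact (hd n).smul continuous_const
    | zero => simpa using continuous_const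
    | add y z _ _ hy hz => simp only [map_add]; exact hy.add hz
    | smul c y _ hy => simp only [map_smul]; exact hy.const_smul c
  -- Local boundedness of the operator norms near `t₀` makes the approximation by vectors in the
  -- span of the basis locally uniform in time.
  refine continuous_iff_continuousAt.2 fun t₀ =>
    continuousAt_of_locally_uniform_approx_of_continuousAt fun u hu => ?_
  obtain ⟨ε, hε, hεu⟩ := Metric.mem_uniformity_dist.1 hu
  set K := |κ t₀| + 1 with hK
  have hKpos : 0 < K := by positivity
  have hx : x ∈ closure (Submodule.span ℂ (range b) : Set E) := by
    have := b.dense_span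
    rw [← Submodule.topologicalClosure_coe, this]
    trivial
  obtain ⟨y, hy, hxy⟩ := Metric.mem_closure_iff.1 hx (ε / K) (div_pos hε hKpos)
  refine ⟨{t | κ t < K}, (hκ.tendsto t₀).eventually_lt_const ?_, fun t => S t y,
    (hspan y hy).continuousAt, fun t ht => hεu ?_⟩
  · rw [hK]
    linarith [le_abs_self (κ t₀)]
  · rw [dist_eq_norm, ← map_sub]
    rw [dist_eq_norm] at hxy
    calc ‖S t (x - y)‖ ≤ κ t * ‖x - y‖ := hb t _
      _ ≤ K * ‖x - y‖ := mul_le_mul_of_nonneg_right (le_of_lt ht) (norm_nonneg _)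
      _ < K * (ε / K) := mul_lt_mul_of_pos_left hxy hKpos
      _ = ε := by field_simp

theorem inner_eq_inner_of_components (b : HilbertBasis ℕ ℂ E) {lam : ℕ → ℝ} {ψ χ x w : E}
    (hψ : ∀ n, inner ℂ (b n) χ = lam n * inner ℂ (b n) ψ)
    (hx : ∀ n, inner ℂ (b n) w = lam n * inner ℂ (b n) x) : inner ℂ χ x = inner ℂ ψ w := by
  rw [← b.tsum_inner_mul_inner, ← b.tsum_inner_mul_inner]
  refine tsum_congr fun n => ?_
  rw [hx, ← inner_conj_symm χ, ← inner_conj_symm ψ, hψ, map_mul, Complex.conj_ofReal]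
  ring

end Diagonal

/-! ### The operator in the basis of eigenvectors -/

/-- For the converse, the coefficients give ⟨w, ψ⟩ = ⟨x, Aψ⟩ for every ψ in the domain, so x lies in
the domain of the adjoint, which is `A` itself. Through this lemma all questions about `A` become
statements on coefficients. -/
theorem mem_graph_iff_components {H : Type*} [NormedAddCommGroup H] [InnerProductSpace ℝ H]
    [CompleteSpace H] {A : H →ₗ.[ℝ] H} (hAd : Dense (A.domain : Set H))
    (hA : IsSelfAdjoint A) {φ : HilbertBasis ℕ ℝ H} {lam : ℕ → ℝ}
    (hφ : ∀ n, ∃ h : φ n ∈ A.domain, A ⟨φ n, h⟩ = lam n • φ n) (x w : H) :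
    (x, w) ∈ A.graph ↔ ∀ n, inner ℝ (φ n) w = lam n * inner ℝ (φ n) x := by
  have hadj : A.adjoint = A := LinearPMap.isSelfAdjoint_def.1 hA
  have hsymm : ∀ x y : A.domain, inner ℝ (A x) (y : H) = inner ℝ (x : H) (A y) := by
    have := LinearPMap.adjoint_isFormalAdjoint hAd
    rw [hadj] at this
    exact fun x y => this x y
  constructor
  · intro h n
    obtain ⟨y, hy, hyw⟩ := LinearPMap.mem_graph_iff _ |>.1 h
    obtain ⟨hn, hA⟩ := hφ n
    simp only at hy hyw
    rw [← hyw, ← hy, ← hsymm ⟨φ n, hn⟩ y, hA, inner_smul_left]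
    simp
  · intro h
    have key : ∀ ψ : A.domain, inner ℝ w (ψ : H) = inner ℝ x (A ψ) := by
      intro ψ
      rw [← φ.tsum_inner_mul_inner, ← φ.tsum_inner_mul_inner]
      refine tsum_congr fun n => ?_
      obtain ⟨hn, hA⟩ := hφ n
      have h1 : inner ℝ (φ n) (A ψ) = lam n * inner ℝ (φ n) (ψ : H) := by
        rw [← hsymm ⟨φ n, hn⟩ ψ, hA, inner_smul_left]
        simp
      rw [h1, real_inner_comm, h, real_inner_comm x]
      ring
    have hmem : x ∈ A.adjoint.domain := LinearPMap.mem_adjoint_domain_of_exists _ ⟨w, key⟩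
    have happ := LinearPMap.adjoint_apply_eq hAd ⟨x, hmem⟩ key
    have : (x, w) ∈ A.adjoint.graph := by
      rw [← happ]
      exact LinearPMap.mem_graph _ ⟨x, hmem⟩
    rwa [hadj] at this

theorem mapPMap_mem_graph_iff {H : Type*} [NormedAddCommGroup H] [InnerProductSpace ℝ H]
    (A : H →ₗ.[ℝ] H) (z w : Complexification H) :
    (z, w) ∈ (Complexification.mapPMap A).graph ↔ (z.re, w.re) ∈ A.graph ∧ (z.im, w.im) ∈ A.graph := by
  simp only [LinearPMap.mem_graph_iff]
  constructor
  · rintro ⟨y, rfl, rfl⟩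
    exact ⟨⟨⟨_, y.2.1⟩, rfl, rfl⟩, ⟨⟨_, y.2.2⟩, rfl, rfl⟩⟩
  · rintro ⟨⟨y, hy, hy'⟩, ⟨y', hz, hz'⟩⟩
    refine ⟨⟨z, ⟨by rw [← hy]; exact y.2, by rw [← hz]; exact y'.2⟩⟩, rfl, ?_⟩
    refine Complexification.ext' ?_ ?_
    · rw [← hy']
      exact congrArg A (Subtype.ext hy.symm)
    · rw [← hz']
      exact congrArg A (Subtype.ext hz.symm)

theorem mapPMap_mem_graph_iff_components {H : Type*} [NormedAddCommGroup H]
    [InnerProductSpace ℝ H] [CompleteSpace H] {A : H →ₗ.[ℝ] H} (hAd : Dense (A.domain : Set H))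
    (hA : IsSelfAdjoint A) {φ : HilbertBasis ℕ ℝ H} {lam : ℕ → ℝ}
    (hφ : ∀ n, ∃ h : φ n ∈ A.domain, A ⟨φ n, h⟩ = lam n • φ n)
    {b : HilbertBasis ℕ ℂ (Complexification H)}
    (hb : ∀ n, b n = Complexification.ofReal (φ n)) (z w : Complexification H) :
    (z, w) ∈ (Complexification.mapPMap A).graph ↔
      ∀ n, inner ℂ (b n) w = lam n * inner ℂ (b n) z := by
  rw [mapPMap_mem_graph_iff, mem_graph_iff_components hAd hA hφ,
    mem_graph_iff_components hAd hA hφ, ← forall_and]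
  refine forall_congr' fun n => ?_
  rw [hb, Complexification.inner_ofReal_left, Complexification.inner_ofReal_left, Complex.ext_iff]
  simp

/-! ### Weak and classical solutions by components -/

@[simp] theorem kernel_zero (δ : ℝ) : kernel δ 0 = 1 := by simp [kernel]

theorem continuous_kernel (δ : ℝ) : Continuous (kernel δ) := by
  unfold kernel
  fun_prop

theorem hasDerivAt_kernel (δ t : ℝ) : HasDerivAt (kernel δ) (-δ * kernel δ t) t := by
  have := (((hasDerivAt_id t).const_mul δ).neg).exp
  refine this.congr_deriv ?_
  simp [kernel, mul_comm]

section Solutions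

variable {H : Type*} [NormedAddCommGroup H] [InnerProductSpace ℝ H]
  {A : H →ₗ.[ℝ] H} {δ : ℝ} {lam : ℕ → ℝ} {b : HilbertBasis ℕ ℂ (Complexification H)}
  {F : ℝ → Complexification H} {y₀ : Complexification H} {y q : ℝ → Complexification H}

theorem inner_intervalIntegral [CompleteSpace H] (x : Complexification H) {u : ℝ → Complexification H}
    (hu : Continuous u) (a c : ℝ) :
    inner ℂ x (∫ s in a..c, u s) = ∫ s in a..c, inner ℂ x (u s) :=
  ((innerSL ℂ x).intervalIntegral_comp_comm (hu.intervalIntegrable a c)).symm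

theorem inner_integral_conv [CompleteSpace H] (x : Complexification H) {k : ℝ → ℂ} {u : ℝ → Complexification H}
    (hk : Continuous k) (hu : Continuous u) (t : ℝ) :
    inner ℂ x (∫ s in (0 : ℝ)..t, k (t - s) • u s)
      = ∫ s in (0 : ℝ)..t, k (t - s) * inner ℂ x (u s) := by
  rw [inner_intervalIntegral x (by fun_prop)]
  simp only [inner_smul_right]

theorem IsWeakSolution.hasDerivWithinAt_component
    (hgraph : ∀ z w, (z, w) ∈ (Complexification.mapPMap A).graph ↔
      ∀ n, inner ℂ (b n) w = lam n * inner ℂ (b n) z)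
    (hy : IsWeakSolution A δ F y₀ y) (n : ℕ) {t : ℝ} (ht : 0 ≤ t) :
    HasDerivWithinAt (fun s => inner ℂ (b n) (y s)) (inner ℂ (b n) (F t)
      - lam n * inner ℂ (b n) (y t)
      - ∫ s in (0 : ℝ)..t, (kernel δ (t - s) : ℂ) * (lam n * inner ℂ (b n) (y s))) (Ici 0) t := by
  have hmem : (b n, (lam n : ℂ) • b n) ∈ (Complexification.mapPMap A).graph := by
    rw [hgraph]
    intro m
    rw [inner_smul_right]
    by_cases h : m = n
    · rw [h]
    · rw [b.orthonormal.2 h, mul_zero, mul_zero]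
  obtain ⟨ψ, hψ, hAψ⟩ := (LinearPMap.mem_graph_iff _).1 hmem
  have := hy.weak_eq ψ t ht
  simpa only [hψ, hAψ, inner_smul_left, Complex.conj_ofReal] using this

/-- Tested against an eigenvector, the difference of two solutions and its convolution with the
kernel solve a homogeneous linear planar system with zero data, to which a Gronwall estimate
applies. -/
theorem IsWeakSolution.unique
    (hgraph : ∀ z w, (z, w) ∈ (Complexification.mapPMap A).graph ↔
      ∀ n, inner ℂ (b n) w = lam n * inner ℂ (b n) z)
    (hlam : ∀ n, 0 ≤ lam n) (hδ : 0 ≤ δ) {y' : ℝ → Complexification H}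
    (hy : IsWeakSolution A δ F y₀ y) (hy' : IsWeakSolution A δ F y₀ y') : EqOn y' y (Ici 0) := by
  intro R hR
  refine hilbertBasis_ext b fun n => ?_
  set w : ℝ → ℂ := fun t => inner ℂ (b n) (y' t) - inner ℂ (b n) (y t) with hw
  -- Extended by its value at 0 to negative times, so that the convolution rule for functions
  -- continuous on ℝ applies.
  set w' : ℝ → ℂ := fun t => w (max t 0) with hw'
  have hmax : ∀ t, 0 ≤ t → w' t = w t := fun t ht => by simp only [hw', max_eq_left ht]
  have hwc : Continuous w' := by
    have h1 : ∀ {z : ℝ → Complexification H}, ContinuousOn z (Ici 0) →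
        Continuous fun t => inner ℂ (b n) (z (max t 0)) := fun hz =>
      continuous_const.inner (hz.comp_continuous (by fun_prop) fun t => le_max_right t 0)
    exact (h1 hy'.continuousOn).sub (h1 hy.continuousOn)
  set ζ : ℝ → ℂ := fun t => ∫ s in (0 : ℝ)..t, (kernel δ (t - s) : ℂ) • w' s with hζ
  have hk := continuous_kernel δ
  have hζd : ∀ t, HasDerivAt ζ (w' t - δ * ζ t) t := by
    intro t
    refine (hasDerivAt_integral_conv (fun t => (hasDerivAt_kernel δ t).ofReal_comp)
      (by fun_prop) hwc t).congr_deriv ?_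
    simp only [kernel_zero, Complex.ofReal_one, one_smul, hζ, ← intervalIntegral.integral_const_mul,
      sub_eq_add_neg, ← intervalIntegral.integral_neg]
    congr 2
    funext s
    push_cast
    simp only [smul_eq_mul]
    ring
  have hwd : ∀ t, 0 ≤ t → HasDerivWithinAt w' (-(lam n * w' t) - lam n * ζ t) (Ici t) t := by
    intro t ht
    have h1 := (hy'.hasDerivWithinAt_component hgraph n ht).sub
      (hy.hasDerivWithinAt_component hgraph n ht)
    have h2 : HasDerivWithinAt w' _ (Ici 0) t := h1.congr (fun s hs => hmax s hs) (hmax t ht)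
    refine (h2.mono (Ici_subset_Ici.2 ht)).congr_deriv ?_
    have hcont : ∀ {z : ℝ → Complexification H}, ContinuousOn z (Ici 0) →
        IntervalIntegrable (fun s => (kernel δ (t - s) : ℂ) * (lam n * inner ℂ (b n) (z s)))
          volume 0 t := by
      intro z hz
      refine ContinuousOn.intervalIntegrable ?_
      rw [uIcc_of_le ht]
      have h3 : ContinuousOn (fun s => inner ℂ (b n) (z s)) (Icc 0 t) :=
        continuousOn_const.inner (hz.mono Icc_subset_Ici_self)
      exact ContinuousOn.mul (by fun_prop) (continuousOn_const.mul h3)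
    have h4 : lam n * ζ t
        = (∫ s in (0 : ℝ)..t, (kernel δ (t - s) : ℂ) * (lam n * inner ℂ (b n) (y' s)))
          - ∫ s in (0 : ℝ)..t, (kernel δ (t - s) : ℂ) * (lam n * inner ℂ (b n) (y s)) := by
      rw [← intervalIntegral.integral_sub (hcont hy'.continuousOn) (hcont hy.continuousOn), hζ,
        ← intervalIntegral.integral_const_mul]
      refine intervalIntegral.integral_congr fun s hs => ?_
      rw [uIcc_of_le ht] at hs
      simp only [hmax s hs.1, hw, smul_eq_mul]
      ring
    rw [h4, hmax t ht]
    simp only [hw]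
    ring
  have h0 : w' 0 = 0 := by
    rw [hmax 0 le_rfl]
    simp only [hw, hy.initial, hy'.initial, sub_self]
  have hcζ : Continuous ζ := continuous_iff_continuousAt.2 fun t => (hζd t).continuousAt
  have := eq_zero_of_abs_deriv_le_mul_abs_self_of_eq_zero_right (f := fun t => (w' t, ζ t))
    (f' := fun t => (-(lam n * w' t) - lam n * ζ t, w' t - δ * ζ t)) (K := 2 * lam n + 1 + δ)
    (a := 0) (b := R) (hwc.prodMk hcζ).continuousOn
    (fun t ht => (hwd t ht.1).prodMk (hζd t).hasDerivWithinAt)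
    (by simp [h0, hζ])
    (fun t _ => by
      have h1 : ‖w' t‖ ≤ ‖(w' t, ζ t)‖ := le_max_left _ _
      have h2 : ‖ζ t‖ ≤ ‖(w' t, ζ t)‖ := le_max_right _ _
      have h3 := hlam n
      set m := ‖(w' t, ζ t)‖
      have hm : 0 ≤ m := (norm_nonneg _).trans h1
      rw [Prod.norm_mk]
      refine max_le ((norm_sub_le _ _).trans ?_) ((norm_sub_le _ _).trans ?_)
      · rw [norm_neg, norm_mul, norm_mul, Complex.norm_real, Real.norm_of_nonneg h3]
        nlinarith [mul_le_mul_of_nonneg_left h1 h3, mul_le_mul_of_nonneg_left h2 h3,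
          mul_nonneg hδ hm]
      · rw [norm_mul, Complex.norm_real, Real.norm_of_nonneg hδ]
        nlinarith [mul_le_mul_of_nonneg_left h2 hδ, mul_nonneg h3 hm]) R ⟨hR, le_rfl⟩
  have h5 : w' R = 0 := congrArg Prod.fst this
  rw [hmax R hR] at h5
  exact sub_eq_zero.1 h5

/-- The Volterra equation of a mode. -/
theorem respP_eq_add_integral (l δ : ℝ) (c : ℂ) {f : ℝ → ℂ} (hf : Continuous f) (t : ℝ) :
    respP l δ c f t = respY l δ c f t
      + ∫ s in (0 : ℝ)..t, (kernel δ (t - s) : ℂ) * respY l δ c f s := by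
  rw [← eq_integral_of_hasDerivAt (continuous_respY l δ c hf) (respZ_zero l δ c f)
    (hasDerivAt_respZ l δ c hf), respY_eq l δ c hf]
  ring

/-- The resolvent form of the Volterra equation of a mode. -/
theorem respY_eq_sub_integral (l δ : ℝ) (c : ℂ) {f : ℝ → ℂ} (hf : Continuous f) (t : ℝ) :
    respY l δ c f t = respP l δ c f t
      - ∫ s in (0 : ℝ)..t, (kernel (1 + δ) (t - s) : ℂ) * respP l δ c f s := by
  rw [← eq_integral_of_hasDerivAt (continuous_respP l δ c hf) (respZ_zero l δ c f)
    fun t => (hasDerivAt_respZ l δ c hf t).congr_deriv ?_, respY_eq l δ c hf]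
  rw [respY_eq l δ c hf]
  push_cast
  ring

/-- A general test vector is not a finite combination of eigenvectors, so the modes are not
differentiated and summed. Instead the integrated identity A∫q = y₀ + ∫F - y, with q = y + β*y, is
checked on coefficients, paired with ψ, and only then differentiated. -/
theorem isWeakSolution_of_components [CompleteSpace H]
    (hgraph : ∀ z w, (z, w) ∈ (Complexification.mapPMap A).graph ↔
      ∀ n, inner ℂ (b n) w = lam n * inner ℂ (b n) z)
    (hF : Continuous F) (hyc : Continuous y) (hqc : Continuous q)
    (hy : ∀ t, 0 ≤ t → ∀ n, inner ℂ (b n) (y t)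
      = respY (lam n) δ (inner ℂ (b n) y₀) (fun s => inner ℂ (b n) (F s)) t)
    (hq : ∀ t, 0 ≤ t → ∀ n, inner ℂ (b n) (q t)
      = respP (lam n) δ (inner ℂ (b n) y₀) (fun s => inner ℂ (b n) (F s)) t) :
    IsWeakSolution A δ F y₀ y := by
  have hFn : ∀ n, Continuous fun s => inner ℂ (b n) (F s) := fun n => continuous_const.inner hF
  have hk := continuous_kernel δ
  have hq' : ∀ t, 0 ≤ t → q t = y t + ∫ s in (0 : ℝ)..t, (kernel δ (t - s) : ℂ) • y s := by
    intro t ht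
    refine hilbertBasis_ext b fun n => ?_
    rw [inner_add_right, inner_integral_conv (k := fun s => (kernel δ s : ℂ)) _ (by fun_prop) hyc,
      hq t ht, hy t ht, respP_eq_add_integral _ _ _ (hFn n)]
    congr 1
    refine intervalIntegral.integral_congr fun s hs => ?_
    rw [uIcc_of_le ht] at hs
    simp only [hy s hs.1]
  have hint : ∀ t, 0 ≤ t →
      (∫ s in (0 : ℝ)..t, q s, y₀ + (∫ s in (0 : ℝ)..t, F s) - y t)
        ∈ (Complexification.mapPMap A).graph := by
    intro t ht
    rw [hgraph]
    intro n
    have h1 := intervalIntegral.integral_eq_sub_of_hasDerivAt (a := 0) (b := t)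
      (fun s _ => hasDerivAt_respY (lam n) δ (inner ℂ (b n) y₀) (hFn n) s)
      (Continuous.intervalIntegrable (by
        have := continuous_respP (lam n) δ (inner ℂ (b n) y₀) (hFn n)
        fun_prop) _ _)
    have hP := continuous_respP (lam n) δ (inner ℂ (b n) y₀) (hFn n)
    rw [intervalIntegral.integral_sub ((hFn n).intervalIntegrable _ _)
      (Continuous.intervalIntegrable (by fun_prop) _ _), intervalIntegral.integral_const_mul,
      respY_zero] at h1
    have h2 : ∫ s in (0 : ℝ)..t, inner ℂ (b n) (q s) = ∫ s in (0 : ℝ)..t,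
        respP (lam n) δ (inner ℂ (b n) y₀) (fun s => inner ℂ (b n) (F s)) s := by
      refine intervalIntegral.integral_congr fun s hs => ?_
      rw [uIcc_of_le ht] at hs
      exact hq s hs.1 n
    rw [inner_sub_right, inner_add_right, inner_intervalIntegral _ hF, inner_intervalIntegral _ hqc,
      hy t ht, h2]
    linear_combination h1
  refine ⟨hyc.continuousOn, ?_, fun ψ t ht => ?_⟩
  · refine hilbertBasis_ext b fun n => ?_
    rw [hy 0 le_rfl, respY_zero]
  · set χ := Complexification.mapPMap A ψ with hχ
    have hψ : ∀ n, inner ℂ (b n) χ = lam n * inner ℂ (b n) (ψ : Complexification H) :=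
      (hgraph _ _).1 (LinearPMap.mem_graph _ ψ)
    have hval : ∀ t, 0 ≤ t → inner ℂ (ψ : Complexification H) (y t)
        = inner ℂ (ψ : Complexification H) y₀
          + ∫ s in (0 : ℝ)..t, (inner ℂ (ψ : Complexification H) (F s) - inner ℂ χ (q s)) := by
      intro t ht
      have h1 := inner_eq_inner_of_components b hψ ((hgraph _ _).1 (hint t ht))
      rw [intervalIntegral.integral_sub ((continuous_const.inner hF).intervalIntegrable _ _)
        ((continuous_const.inner hqc).intervalIntegrable _ _), ← inner_intervalIntegral _ hF,
        ← inner_intervalIntegral _ hqc, h1, inner_sub_right, inner_add_right]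
      ring
    have hd : HasDerivAt (fun t => inner ℂ (ψ : Complexification H) y₀
        + ∫ s in (0 : ℝ)..t, (inner ℂ (ψ : Complexification H) (F s) - inner ℂ χ (q s)))
        (inner ℂ (ψ : Complexification H) (F t) - inner ℂ χ (q t)) t := by
      refine HasDerivAt.const_add _ ?_
      exact (((continuous_const.inner hF).sub
        (continuous_const.inner hqc)).integral_hasStrictDerivAt 0 t).hasDerivAt
    refine (hd.hasDerivWithinAt.congr (fun s hs => hval s hs) (hval t ht)).congr_deriv ?_
    rw [hq' t ht, inner_add_right,
      inner_integral_conv (k := fun s => (kernel δ s : ℂ)) _ (by fun_prop) hyc]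
    ring

/-- The coefficients of F - y' are those of A(y + β*y). The convolution equation is inverted by the
resolvent kernel e^{-(1+δ)t}, which yields Ay as a continuous function without differentiating a
series. -/
theorem isClassicalSolution_of_components [CompleteSpace H]
    (hgraph : ∀ z w, (z, w) ∈ (Complexification.mapPMap A).graph ↔
      ∀ n, inner ℂ (b n) w = lam n * inner ℂ (b n) z)
    (hF : Continuous F)
    (hy : ∀ t, 0 ≤ t → ∀ n, inner ℂ (b n) (y t)
      = respY (lam n) δ (inner ℂ (b n) y₀) (fun s => inner ℂ (b n) (F s)) t)
    {Y D : ℝ → Complexification H} (hD : Continuous D) (hYD : ∀ t, HasDerivAt Y (D t) t)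
    (hYy : EqOn y Y (Ici 0)) : IsClassicalSolution A δ F y₀ y := by
  have hFn : ∀ n, Continuous fun s => inner ℂ (b n) (F s) := fun n => continuous_const.inner hF
  have hk := continuous_kernel δ
  have hk' := continuous_kernel (1 + δ)
  have hDn : ∀ t, 0 ≤ t → ∀ n, inner ℂ (b n) (F t - D t)
      = lam n * respP (lam n) δ (inner ℂ (b n) y₀) (fun s => inner ℂ (b n) (F s)) t := by
    intro t ht n
    have h1 := ((innerSL ℂ (b n)).restrictScalars ℝ).hasFDerivAt.comp_hasDerivAt t (hYD t)
    have h2 := hasDerivAt_respY (lam n) δ (inner ℂ (b n) y₀) (hFn n) t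
    have h3 : EqOn (respY (lam n) δ (inner ℂ (b n) y₀) (fun s => inner ℂ (b n) (F s)))
        (((innerSL ℂ (b n)).restrictScalars ℝ) ∘ Y) (Ici 0) := by
      intro s hs
      rw [← hy s hs, hYy hs]
      rfl
    have h4 := (uniqueDiffOn_Ici (0 : ℝ) t ht).eq_deriv _
      (h1.hasDerivWithinAt.congr h3 (h3 ht)) h2.hasDerivWithinAt
    rw [inner_sub_right, show inner ℂ (b n) (D t) = _ from h4]
    ring
  set z : ℝ → Complexification H := fun t =>
    (F t - D t) - ∫ s in (0 : ℝ)..t, (kernel (1 + δ) (t - s) : ℂ) • (F s - D s) with hz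
  have hzc : Continuous z := (hF.sub hD).sub
    (continuous_integral_conv (k := fun s => (kernel (1 + δ) s : ℂ)) (by fun_prop) (hF.sub hD))
  have hzn : ∀ t, 0 ≤ t → ∀ n, inner ℂ (b n) (z t)
      = lam n * respY (lam n) δ (inner ℂ (b n) y₀) (fun s => inner ℂ (b n) (F s)) t := by
    intro t ht n
    rw [hz, inner_sub_right, inner_integral_conv (k := fun s => (kernel (1 + δ) s : ℂ))
      (u := fun s => F s - D s) _ (by fun_prop) (hF.sub hD), hDn t ht, respY_eq_sub_integral _ _ _ (hFn n), mul_sub,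
      ← intervalIntegral.integral_const_mul]
    congr 1
    refine intervalIntegral.integral_congr fun s hs => ?_
    rw [uIcc_of_le ht] at hs
    simp only [hDn s hs.1]
    ring
  have hYc : ContDiff ℝ 1 Y := by
    rw [contDiff_one_iff_deriv]
    refine ⟨fun t => (hYD t).differentiableAt, ?_⟩
    rwa [show deriv Y = D from funext fun t => (hYD t).deriv]
  refine ⟨hYc.contDiffOn.congr hYy, ?_, z, hzc.continuousOn, fun t ht => ?_, fun t ht => ?_⟩
  · refine hilbertBasis_ext b fun n => ?_
    rw [hy 0 le_rfl, respY_zero]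
  · rw [hgraph]
    intro n
    rw [hzn t ht, hy t ht]
  · refine ((hYD t).hasDerivWithinAt.congr hYy (hYy ht)).congr_deriv ?_
    refine hilbertBasis_ext b fun n => ?_
    have h1 := hDn t ht n
    rw [inner_sub_right] at h1
    have h2 : ∫ s in (0 : ℝ)..t, (kernel δ (t - s) : ℂ) * inner ℂ (b n) (z s)
        = lam n * ∫ s in (0 : ℝ)..t, (kernel δ (t - s) : ℂ)
          * respY (lam n) δ (inner ℂ (b n) y₀) (fun s => inner ℂ (b n) (F s)) s := by
      rw [← intervalIntegral.integral_const_mul]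
      refine intervalIntegral.integral_congr fun s hs => ?_
      rw [uIcc_of_le ht] at hs
      simp only [hzn s hs.1]
      ring
    rw [inner_sub_right, inner_sub_right, hzn t ht,
      inner_integral_conv (k := fun s => (kernel δ s : ℂ)) _ (by fun_prop) hzc, h2]
    rw [respP_eq_add_integral _ _ _ (hFn n)] at h1
    linear_combination -h1

end Solutions

/-! ### The solution of the controlled equation -/

section Families

variable {E : Type*} [NormedAddCommGroup E] [InnerProductSpace ℂ E]

theorem exists_diagonal_family (b : HilbertBasis ℕ ℂ E) {d : ℝ → ℕ → ℂ}
    (hd : ∀ n, Continuous fun t => d t n) {κ : ℝ → ℝ} (hκ : Continuous κ)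
    (hb : ∀ t n, ‖d t n‖ ≤ κ t) :
    ∃ S : ℝ → E →L[ℂ] E, (∀ t x n, inner ℂ (b n) (S t x) = d t n * inner ℂ (b n) x) ∧
      (∀ x, Continuous fun t => S t x) ∧ ∀ t x, ‖S t x‖ ≤ κ t * ‖x‖ := by
  choose S hS hSn using fun t => exists_diagonal b (hb t)
  exact ⟨S, hSn, continuous_diagonal_apply b hSn hd hκ hS, hS⟩

/-- The variation of constants formula. -/
noncomputable def duhamel {M : ℕ} (S : ℝ → E →L[ℂ] E) (x : E) (v : Fin M → ℝ → ℂ) (g : Fin M → E)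
    (t : ℝ) : E :=
  S t x + ∑ i, ∫ s in (0 : ℝ)..t, v i (t - s) • S s (g i)

variable {M : ℕ} {S : ℝ → E →L[ℂ] E} (x : E) {v : Fin M → ℝ → ℂ} {g : Fin M → E}

theorem continuous_duhamel (hS : ∀ x, Continuous fun t => S t x) (hv : ∀ i, Continuous (v i)) :
    Continuous (duhamel S x v g) :=
  (hS x).add (continuous_finsetSum _ fun i _ => continuous_integral_conv (hv i) (hS (g i)))

/-- A control decaying faster by one unit of rate than the family makes the convolution cost no
polynomial factor: e^{(κ-1)t}∫₀ᵗ eˢ ds ≤ e^{κt}. It serves with κ = 1 for all modes and κ = -γ for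
the stable ones. -/
theorem norm_duhamel_le {K κ V : ℝ} (hK : 0 ≤ K) (hV : 0 ≤ V)
    (hS : ∀ t, 0 ≤ t → ∀ x, ‖S t x‖ ≤ K * Real.exp (κ * t) * ‖x‖)
    (hv : ∀ i t, 0 ≤ t → ‖v i t‖ ≤ V * Real.exp ((κ - 1) * t)) {t : ℝ} (ht : 0 ≤ t) :
    ‖duhamel S x v g t‖ ≤ K * Real.exp (κ * t) * (‖x‖ + V * ∑ i, ‖g i‖) := by
  have h1 : ∀ i, ‖∫ s in (0 : ℝ)..t, v i (t - s) • S s (g i)‖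
      ≤ K * Real.exp (κ * t) * (V * ‖g i‖) := by
    intro i
    have h2 : ∀ s ∈ Ioc 0 t, ‖v i (t - s) • S s (g i)‖
        ≤ V * K * ‖g i‖ * (Real.exp ((κ - 1) * t) * Real.exp s) := by
      intro s hs
      rw [norm_smul]
      calc _ ≤ (V * Real.exp ((κ - 1) * (t - s))) * (K * Real.exp (κ * s) * ‖g i‖) :=
            mul_le_mul (hv i _ (sub_nonneg.2 hs.2)) (hS s hs.1.le _) (norm_nonneg _) (by positivity)
        _ = V * K * ‖g i‖ * (Real.exp ((κ - 1) * (t - s)) * Real.exp (κ * s)) := by ring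
        _ = _ := by
            rw [← Real.exp_add, ← Real.exp_add]
            ring_nf
    refine (intervalIntegral.norm_integral_le_of_norm_le ht (Eventually.of_forall h2)
      (Continuous.intervalIntegrable (by fun_prop) _ _)).trans ?_
    rw [intervalIntegral.integral_const_mul, intervalIntegral.integral_const_mul, integral_exp,
      Real.exp_zero]
    calc _ ≤ V * K * ‖g i‖ * (Real.exp ((κ - 1) * t) * Real.exp t) := by
          gcongr
          linarith
      _ = K * Real.exp (κ * t) * (V * ‖g i‖) := by
          rw [← Real.exp_add]
          ring_nf
  calc _ ≤ ‖S t x‖ + ∑ i, ‖∫ s in (0 : ℝ)..t, v i (t - s) • S s (g i)‖ :=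
        (norm_add_le _ _).trans (add_le_add le_rfl (norm_sum_le _ _))
    _ ≤ K * Real.exp (κ * t) * ‖x‖ + ∑ i, K * Real.exp (κ * t) * (V * ‖g i‖) :=
        add_le_add (hS t ht x) (Finset.sum_le_sum fun i _ => h1 i)
    _ = _ := by rw [← Finset.mul_sum, ← Finset.mul_sum]; ring

theorem hasDerivAt_duhamel_forcing [CompleteSpace E] (hS : ∀ x, Continuous fun t => S t x)
    {v' : Fin M → ℝ → ℂ}
    (hv : ∀ i t, HasDerivAt (v i) (v' i t) t) (hv' : ∀ i, Continuous (v' i)) (t : ℝ) :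
    HasDerivAt (fun t => ∑ i, ∫ s in (0 : ℝ)..t, v i (t - s) • S s (g i))
      (∑ i, (v i 0 • S t (g i) + ∫ s in (0 : ℝ)..t, v' i (t - s) • S s (g i))) t :=
  HasDerivAt.fun_sum fun i _ => hasDerivAt_integral_conv (hv i) (hv' i) (hS (g i)) t

end Families

section Solution

variable {H : Type*} [NormedAddCommGroup H] [InnerProductSpace ℝ H] [CompleteSpace H]
  {b : HilbertBasis ℕ ℂ (Complexification H)} {M : ℕ}

/-- The modes are bounded uniformly in n only for nonnegative times; `max t 0` freezes them before 0
so that the operators exist for every real t. -/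
theorem inner_duhamel {S : ℝ → Complexification H →L[ℂ] Complexification H} {m : ℕ → ℝ → ℝ}
    (hS : ∀ t x n, inner ℂ (b n) (S t x) = m n (max t 0) * inner ℂ (b n) x)
    (hSc : ∀ x, Continuous fun t => S t x) (hm : ∀ n, Continuous (m n))
    (x : Complexification H) {v : Fin M → ℝ → ℂ} (hv : ∀ i, Continuous (v i))
    (g : Fin M → Complexification H) {t : ℝ} (ht : 0 ≤ t) (n : ℕ) :
    inner ℂ (b n) (duhamel S x v g t) = m n t * inner ℂ (b n) x
      + ∫ s in (0 : ℝ)..t, (m n (t - s) : ℂ) • inner ℂ (b n) (∑ i, v i s • g i) := by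
  have hm' := hm n
  have h1 : ∀ i, inner ℂ (b n) (∫ s in (0 : ℝ)..t, v i (t - s) • S s (g i))
      = ∫ s in (0 : ℝ)..t, (m n (t - s) : ℂ) * (v i s * inner ℂ (b n) (g i)) := by
    intro i
    rw [inner_integral_conv _ (hv i) (hSc (g i))]
    have h := intervalIntegral.integral_comp_sub_left (a := 0) (b := t)
      (fun s => (m n (t - s) : ℂ) * (v i s * inner ℂ (b n) (g i))) t
    rw [sub_zero, sub_self] at h
    rw [← h]
    refine intervalIntegral.integral_congr fun s hs => ?_
    rw [uIcc_of_le ht] at hs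
    simp only [hS, max_eq_left hs.1, sub_sub_cancel]
    ring
  rw [duhamel, inner_add_right, hS, max_eq_left ht, inner_sum]
  congr 1
  simp_rw [h1, inner_sum, inner_smul_right, smul_eq_mul, Finset.mul_sum]
  rw [intervalIntegral.integral_finsetSum]
  intro i _
  exact Continuous.intervalIntegrable (by fun_prop) _ _

/-- The controlled equation with a `C¹` control: existence, uniqueness, regularity, and the
components of the solution. -/
theorem exists_solution {A : H →ₗ.[ℝ] H} {δ : ℝ} {lam : ℕ → ℝ} (hδ : 0 ≤ δ)
    (hgraph : ∀ z w, (z, w) ∈ (Complexification.mapPMap A).graph ↔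
      ∀ n, inner ℂ (b n) w = lam n * inner ℂ (b n) z)
    (hlam : ∀ n, 0 ≤ lam n)
    {S : ℝ → Complexification H →L[ℂ] Complexification H}
    (hS : ∀ t x n, inner ℂ (b n) (S t x) = modeY (lam n) δ (max t 0) * inner ℂ (b n) x)
    (hSc : ∀ x, Continuous fun t => S t x)
    (y₀ : Complexification H) {v : Fin M → ℝ → ℂ} (hv : ∀ i, ContDiff ℝ 1 (v i))
    (g : Fin M → Complexification H) :
    IsWeakSolution A δ (fun t => ∑ i, v i t • g i) y₀ (duhamel S y₀ v g) ∧
      (y₀ ∈ (Complexification.mapPMap A).domain →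
        IsClassicalSolution A δ (fun t => ∑ i, v i t • g i) y₀ (duhamel S y₀ v g)) := by
  have hvc : ∀ i, Continuous (v i) := fun i => (hv i).continuous
  have hF : Continuous fun t => ∑ i, v i t • g i :=
    continuous_finsetSum _ fun i _ => (hvc i).smul continuous_const
  obtain ⟨P, hP, hPc, -⟩ := exists_diagonal_family b
    (d := fun t n => (modeP (lam n) δ (max t 0) : ℂ)) (κ := fun t => Real.exp (1 * max t 0))
    (fun n => by
      have := continuous_modeP (lam n) δ
      fun_prop)
    (by fun_prop)
    (fun t n => by
      rw [Complex.norm_real, Real.norm_eq_abs]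
      exact abs_modeP_le hδ (by linarith [hlam n]) (by linarith) (le_max_right _ _))
  have hy : ∀ t, 0 ≤ t → ∀ n, inner ℂ (b n) (duhamel S y₀ v g t)
      = respY (lam n) δ (inner ℂ (b n) y₀) (fun s => inner ℂ (b n) (∑ i, v i s • g i)) t :=
    fun t ht n => inner_duhamel (m := fun n => modeY (lam n) δ) hS hSc
      (fun n => continuous_modeY _ _) y₀ hvc g ht n
  have hq : ∀ t, 0 ≤ t → ∀ n, inner ℂ (b n) (duhamel P y₀ v g t)
      = respP (lam n) δ (inner ℂ (b n) y₀) (fun s => inner ℂ (b n) (∑ i, v i s • g i)) t :=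
    fun t ht n => inner_duhamel (m := fun n => modeP (lam n) δ) hP hPc
      (fun n => continuous_modeP _ _) y₀ hvc g ht n
  refine ⟨isWeakSolution_of_components hgraph hF (continuous_duhamel y₀ hSc hvc)
    (continuous_duhamel y₀ hPc hvc) hy hq, fun hy₀ => ?_⟩
  set w := Complexification.mapPMap A ⟨y₀, hy₀⟩ with hw
  have hwn : ∀ n, inner ℂ (b n) w = lam n * inner ℂ (b n) y₀ :=
    (hgraph _ _).1 (LinearPMap.mem_graph _ ⟨y₀, hy₀⟩)
  have hvd : ∀ i t, HasDerivAt (v i) (deriv (v i) t) t := fun i t =>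
    ((hv i).differentiable one_ne_zero t).hasDerivAt
  have hvd' : ∀ i, Continuous (deriv (v i)) := fun i => (hv i).continuous_deriv le_rfl
  -- For y₀ in the domain, S(t)y₀ = y₀ - ∫₀ᵗ P(s)Ay₀ ds, because `modeY' = -l modeP`. The right side
  -- is differentiable on all of ℝ, also where `S` is frozen.
  refine isClassicalSolution_of_components hgraph hF hy
    (Y := fun t => (y₀ - ∫ s in (0 : ℝ)..t, P s w)
      + ∑ i, ∫ s in (0 : ℝ)..t, v i (t - s) • S s (g i))
    (D := fun t => -P t w
      + ∑ i, (v i 0 • S t (g i) + ∫ s in (0 : ℝ)..t, deriv (v i) (t - s) • S s (g i)))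
    ?_ (fun t => ?_) fun t ht => ?_
  · exact (hPc w).neg.add (continuous_finsetSum _ fun i _ => ((hSc (g i)).const_smul (v i 0)).add
      (continuous_integral_conv (hvd' i) (hSc (g i))))
  · exact (((hPc w).integral_hasStrictDerivAt 0 t).hasDerivAt.const_sub y₀).add
      (hasDerivAt_duhamel_forcing hSc hvd hvd' t)
  · rw [duhamel]
    congr 1
    refine hilbertBasis_ext b fun n => ?_
    have h1 := intervalIntegral.integral_eq_sub_of_hasDerivAt (a := 0) (b := t)
      (fun s _ => hasDerivAt_modeY (lam n) δ s)
      (Continuous.intervalIntegrable (by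
        have := continuous_modeP (lam n) δ
        fun_prop) _ _)
    have h2 : ∫ s in (0 : ℝ)..t, inner ℂ (b n) (P s w)
        = -inner ℂ (b n) y₀ * ((∫ s in (0 : ℝ)..t, -lam n * modeP (lam n) δ s : ℝ) : ℂ) := by
      rw [← intervalIntegral.integral_ofReal, ← intervalIntegral.integral_const_mul]
      refine intervalIntegral.integral_congr fun s hs => ?_
      rw [uIcc_of_le ht] at hs
      simp only [hP, hwn, max_eq_left hs.1]
      push_cast
      ring
    rw [hS, max_eq_left ht, inner_sub_right, inner_intervalIntegral _ (hPc w), h2, h1, modeY_zero]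
    push_cast
    ring

end Solution

/-! ### The stabilizing control -/

theorem deriv_eq_zero_of_vanishing {f : ℝ → ℂ} (hf : Differentiable ℝ f) {T : ℝ}
    (hT : ∀ t, T ≤ t → f t = 0) (t : ℝ) (ht : T ≤ t) : deriv f t = 0 :=
  (uniqueDiffOn_Ici T t ht).eq_deriv _ (hf t).hasDerivAt.hasDerivWithinAt
    ((hasDerivWithinAt_const t (Ici T) (0 : ℂ)).congr (fun s hs => hT s hs) (hT t ht))

theorem differentiable_deriv {f : ℝ → ℂ} (hf : ContDiff ℝ 2 f) : Differentiable ℝ (deriv f) :=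
  ((contDiff_succ_iff_deriv (n := 1)).1 hf).2.2.differentiable one_ne_zero

theorem continuous_deriv_deriv {f : ℝ → ℂ} (hf : ContDiff ℝ 2 f) : Continuous (deriv (deriv f)) :=
  ((contDiff_succ_iff_deriv (n := 1)).1 hf).2.2.continuous_deriv le_rfl

theorem exists_exp_bound_of_vanishing {f : ℝ → ℂ} (hf : ContDiff ℝ 2 f) {T : ℝ}
    (hT : ∀ t, T ≤ t → f t = 0) (ρ : ℝ) :
    ∃ K : ℝ, 0 ≤ K ∧ ∀ t, 0 ≤ t →
      ‖f t‖ + ‖deriv f t‖ + ‖deriv (deriv f) t‖ ≤ K * Real.exp (-(ρ * t)) := by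
  have h0 := hf.continuous
  have h1 := (differentiable_deriv hf).continuous
  have h2 := continuous_deriv_deriv hf
  have hd1 := deriv_eq_zero_of_vanishing (hf.differentiable two_ne_zero) hT
  have hd2 := deriv_eq_zero_of_vanishing (differentiable_deriv hf) hd1
  obtain ⟨K, hK⟩ := (isCompact_Icc (a := 0) (b := T)).exists_bound_of_continuousOn
    (f := fun t => (‖f t‖ + ‖deriv f t‖ + ‖deriv (deriv f) t‖) * Real.exp (ρ * t))
    (Continuous.continuousOn (by fun_prop))
  refine ⟨max K 0, le_max_right _ _, fun t ht => ?_⟩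
  rcases le_total t T with htT | htT
  · have := (le_abs_self _).trans ((hK t ⟨ht, htT⟩).trans (le_max_left K 0))
    rw [Real.exp_neg, ← div_eq_mul_inv, le_div_iff₀ (Real.exp_pos _)]
    exact this
  · rw [hT t htT, hd1 t htT, hd2 t htT]
    simp only [norm_zero, add_zero]
    positivity

/-- A linear combination of basic controls. -/
noncomputable def combine {N M : ℕ} (V : Fin N → Fin M → ℝ → ℂ) (c : Fin N → ℂ) : Fin M → ℝ → ℂ :=
  fun i t => ∑ m, c m * V m i t

section Combine

variable {N M : ℕ} {V : Fin N → Fin M → ℝ → ℂ}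

theorem contDiff_combine
    (hV : ∀ m i, ContDiff ℝ 2 (V m i)) (c : Fin N → ℂ) (i : Fin M) : ContDiff ℝ 2 (combine V c i) :=
  ContDiff.sum fun m _ => contDiff_const.mul (hV m i)

theorem norm_combine_le
    (hV : ∀ m i, ContDiff ℝ 2 (V m i)) (c : Fin N → ℂ) {R ρ : ℝ} (hc : ∀ m, ‖c m‖ ≤ R) {K : Fin N → Fin M → ℝ}
    (hK0 : ∀ m i, 0 ≤ K m i)
    (hK : ∀ m i t, 0 ≤ t → ‖V m i t‖ + ‖deriv (V m i) t‖ + ‖deriv (deriv (V m i)) t‖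
      ≤ K m i * Real.exp (-(ρ * t))) (i : Fin M) {t : ℝ} (ht : 0 ≤ t) :
    ‖combine V c i t‖ + ‖deriv (combine V c i) t‖ + ‖deriv (deriv (combine V c i)) t‖
      ≤ (∑ i, ∑ m, K m i) * Real.exp (-(ρ * t)) * R := by
  have h1 : deriv (combine V c i) = fun t => ∑ m, c m * deriv (V m i) t := by
    funext t
    exact (HasDerivAt.fun_sum fun m _ =>
      (((hV m i).differentiable two_ne_zero t).hasDerivAt.const_mul (c m))).deriv
  have h2 : deriv (deriv (combine V c i)) = fun t => ∑ m, c m * deriv (deriv (V m i)) t := by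
    rw [h1]
    funext t
    exact (HasDerivAt.fun_sum fun m _ =>
      ((differentiable_deriv (hV m i) t).hasDerivAt.const_mul (c m))).deriv
  have hs : ∀ a : Fin N → ℂ, ‖∑ m, c m * a m‖ ≤ ∑ m, ‖c m‖ * ‖a m‖ := fun a =>
    (norm_sum_le _ _).trans_eq (Finset.sum_congr rfl fun m _ => norm_mul _ _)
  rw [h2, h1]
  calc _ ≤ ∑ m, ‖c m‖ * ‖V m i t‖ + ∑ m, ‖c m‖ * ‖deriv (V m i) t‖
        + ∑ m, ‖c m‖ * ‖deriv (deriv (V m i)) t‖ := add_le_add (add_le_add (hs _) (hs _)) (hs _)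
    _ = ∑ m, ‖c m‖ * (‖V m i t‖ + ‖deriv (V m i) t‖ + ‖deriv (deriv (V m i)) t‖) := by
        simp only [mul_add, Finset.sum_add_distrib]
    _ ≤ ∑ m, R * (K m i * Real.exp (-(ρ * t))) := Finset.sum_le_sum fun m _ =>
        mul_le_mul (hc m) (hK m i t ht) (by positivity) ((norm_nonneg _).trans (hc m))
    _ = (∑ m, K m i) * (Real.exp (-(ρ * t)) * R) := by
        rw [Finset.sum_mul]
        exact Finset.sum_congr rfl fun m _ => by ring
    _ ≤ (∑ i, ∑ m, K m i) * (Real.exp (-(ρ * t)) * R) := by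
        -- The nonnegativity of `R` is read off from a coefficient bound, which requires at least
        -- one mode.
        rcases Nat.eq_zero_or_pos N with hN | hN
        · subst hN
          simp
        · refine mul_le_mul_of_nonneg_right (Finset.single_le_sum (f := fun i => ∑ m, K m i)
            (fun i _ => Finset.sum_nonneg fun m _ => hK0 m i) (Finset.mem_univ i))
            (mul_nonneg (Real.exp_pos _).le ((norm_nonneg _).trans (hc ⟨0, hN⟩)))
    _ = _ := by ring

theorem integral_mul_combine
    (hV : ∀ m i, ContDiff ℝ 2 (V m i)) (c : Fin N → ℂ) (C : Fin M → ℂ) {p : ℝ → ℝ} (hp : Continuous p) (T : ℝ) :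
    ∫ s in (0 : ℝ)..T, (p s : ℂ) * ∑ i, combine V c i s * C i
      = ∑ m, c m * ∫ s in (0 : ℝ)..T, (p s : ℂ) * ∑ i, C i * V m i s := by
  have hVc : ∀ m i, Continuous (V m i) := fun m i => (hV m i).continuous
  simp_rw [← intervalIntegral.integral_const_mul]
  rw [← intervalIntegral.integral_finsetSum fun m _ =>
    Continuous.intervalIntegrable (by fun_prop) _ _]
  congr 1
  funext s
  simp only [combine, Finset.mul_sum, Finset.sum_mul]
  rw [Finset.sum_comm]
  exact Finset.sum_congr rfl fun m _ => Finset.sum_congr rfl fun i _ => by ring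

end Combine

variable {H : Type*} [NormedAddCommGroup H] [InnerProductSpace ℝ H]

theorem Stabilizes.mono {A : H →ₗ.[ℝ] H} {B : H →L[ℝ] H} {δ γ C C' : ℝ}
    {u : ℝ → Complexification H} {y₀ : Complexification H} (h : Stabilizes A B δ γ C u y₀)
    (hC : C ≤ C') : Stabilizes A B δ γ C' u y₀ := by
  obtain ⟨y, h1, h2, h3, h4⟩ := h
  exact ⟨y, h1, h2, h3, fun t ht => (h4 t ht).trans (by gcongr)⟩

theorem mapL_control (B : H →L[ℝ] H) {M : ℕ} (Φ : Fin M → Complexification H)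
    (v : Fin M → ℝ → ℂ) : (fun t => Complexification.mapL B (control Φ v t))
      = fun t => ∑ i, v i t • Complexification.mapL B (Φ i) := by
  funext t
  simp only [control, map_sum, map_smul]

/-- If the rows of the control matrix are independent in each group of eigenvalues, a `C²` control
that vanishes after time `T` stabilizes the equation with rate `γ`. -/
theorem exists_stabilizing_control [CompleteSpace H]
    {A : H →ₗ.[ℝ] H} (hA_dense : Dense (A.domain : Set H)) (hA_selfAdjoint : IsSelfAdjoint A)
    (hA_resolvent : HasCompactResolvent A) (B : H →L[ℝ] H)
    (φ : HilbertBasis ℕ ℝ H) {lam : ℕ → ℝ} (hlam : Monotone lam) (hlam0 : ∀ n, 0 ≤ lam n)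
    (hφ : ∀ n, ∃ h : φ n ∈ A.domain, A ⟨φ n, h⟩ = lam n • φ n)
    {δ γ : ℝ} (hδ : 0 < δ) (hγ : 0 < γ) (hγδ : γ < δ + 1) {M : ℕ}
    (Φ : Fin M → Complexification H)
    (hC : ∀ (l : ℝ) (a : Fin (unstableDim lam δ γ) → ℂ),
      (∀ n : Fin (unstableDim lam δ γ), lam n ≠ l → a n = 0) →
      (∀ i, ∑ n, a n * inner ℂ (Complexification.ofReal (φ n))
        (Complexification.mapL B (Φ i)) = 0) → a = 0) {T : ℝ} (hT : 0 < T) :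
    ∃ C : ℝ, 0 ≤ C ∧ ∀ y₀ : Complexification H, ∃ v : Fin M → ℝ → ℂ,
      (∀ i, ContDiff ℝ 2 (v i)) ∧ (∀ i t, T ≤ t → v i t = 0) ∧
      (∀ i t, 0 ≤ t → ‖v i t‖ + ‖deriv (v i) t‖ + ‖deriv (deriv (v i)) t‖
        ≤ C * Real.exp (-(γ * t)) * ‖y₀‖) ∧
      Stabilizes A B δ γ C (control Φ v) y₀ := by
  set N := unstableDim lam δ γ with hN
  obtain ⟨b, hb⟩ := Complexification.exists_hilbertBasis φ
  have hgraph := mapPMap_mem_graph_iff_components hA_dense hA_selfAdjoint hφ hb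
  have hunb := exists_le_eigenvalue hA_resolvent φ.orthonormal hlam0 hφ
  obtain ⟨Ks, hKs0, hKs⟩ := exists_modeY_decay hlam hunb hδ hγ hγδ
  set g : Fin M → Complexification H := fun i => Complexification.mapL B (Φ i) with hg
  choose V hVd hVT hVm using exists_mode_control (lam := fun n : Fin N => lam n) hδ hT
    (C := fun n i => inner ℂ (b n) (g i)) (by simpa only [hb] using hC)
  -- Controls vanishing after `T` decay at any rate; γ+1 leaves the unit of margin asked for by
  -- `norm_duhamel_le`.
  choose K hK0 hK using fun m i => exists_exp_bound_of_vanishing (hVd m i) (hVT m i) (γ + 1)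
  set Kv : ℝ := ∑ i, ∑ m, K m i with hKv
  have hKv0 : 0 ≤ Kv := Finset.sum_nonneg fun i _ => Finset.sum_nonneg fun m _ => hK0 m i
  set G : ℝ := ∑ i, ‖g i‖ with hG
  have hG0 : 0 ≤ G := Finset.sum_nonneg fun i _ => norm_nonneg _
  obtain ⟨S, hS, hSc, hSb⟩ := exists_diagonal_family b
    (d := fun t n => (modeY (lam n) δ (max t 0) : ℂ)) (κ := fun t => 2 * Real.exp (1 * max t 0))
    (fun n => by
      have := continuous_modeY (lam n) δ
      fun_prop)
    (by fun_prop)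
    (fun t n => by
      rw [Complex.norm_real, Real.norm_eq_abs]
      exact abs_modeY_le hδ.le (by linarith [hlam0 n]) (by linarith) (le_max_right _ _))
  -- The stable part of the evolution: the first `N` modes are removed.
  set ms : ℕ → ℝ → ℝ := fun n t => if N ≤ n then modeY (lam n) δ t else 0 with hms
  have hmsc : ∀ n, Continuous (ms n) := by
    intro n
    by_cases h : N ≤ n
    · simp only [hms, if_pos h]
      exact continuous_modeY _ _
    · simp only [hms, if_neg h]
      exact continuous_const
  obtain ⟨S', hS', hSc', hSb'⟩ := exists_diagonal_family b
    (d := fun t n => (ms n (max t 0) : ℂ)) (κ := fun t => Ks * Real.exp (-(γ * max t 0)))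
    (fun n => by
      have := hmsc n
      fun_prop)
    (by fun_prop)
    (fun t n => by
      rw [Complex.norm_real, Real.norm_eq_abs]
      by_cases h : N ≤ n
      · simp only [hms, if_pos h]
        exact hKs n h _ (le_max_right _ _)
      · simp only [hms, if_neg h, abs_zero]
        positivity)
  -- The three terms bound the controls, the solution up to `T` (growth eᵗ traded for
  -- e^{(1+γ)T}e^{-γt}), and the solution after `T`.
  set C : ℝ := Kv + (2 * Real.exp ((1 + γ) * T) + Ks) * (1 + Kv * G) with hCdef
  have hKvC : Kv ≤ C := le_add_of_nonneg_right (by positivity)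
  refine ⟨C, hKv0.trans hKvC, fun y₀ => ?_⟩
  set c : Fin N → ℂ := fun n => inner ℂ (b n) y₀ with hc
  have hcy : ∀ n, ‖c n‖ ≤ ‖y₀‖ := fun n => by
    simpa [b.orthonormal.1] using norm_inner_le_norm (𝕜 := ℂ) (b n) y₀
  set v := combine V c with hv
  have hvd : ∀ i, ContDiff ℝ 2 (v i) := contDiff_combine hVd c
  have hvc : ∀ i, Continuous (v i) := fun i => (hvd i).continuous
  have hvT : ∀ i t, T ≤ t → v i t = 0 := fun i t ht =>
    Finset.sum_eq_zero fun m _ => by rw [hVT m i t ht, mul_zero]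
  have hvb := fun i {t : ℝ} (ht : 0 ≤ t) => norm_combine_le hVd c hcy hK0 hK i ht
  have hv1 : ∀ i {t : ℝ}, 0 ≤ t → ‖v i t‖ ≤ Kv * ‖y₀‖ * Real.exp (-((γ + 1) * t)) := by
    intro i t ht
    refine le_trans ?_ ((hvb i ht).trans_eq (by ring))
    have := norm_nonneg (deriv (v i) t)
    have := norm_nonneg (deriv (deriv (v i)) t)
    linarith
  refine ⟨v, hvd, hvT, fun i t ht => (hvb i ht).trans ?_, ?_⟩
  · refine mul_le_mul_of_nonneg_right (mul_le_mul hKvC (Real.exp_le_exp.2 ?_) (Real.exp_pos _).le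
      (hKv0.trans hKvC)) (norm_nonneg _)
    linarith
  obtain ⟨hw, hcl⟩ := exists_solution hδ.le hgraph hlam0 hS hSc y₀
    (fun i => (hvd i).of_le one_le_two) g
  rw [Stabilizes, mapL_control]
  refine ⟨duhamel S y₀ v g, hw, fun z hz => hw.unique hgraph hlam0 hδ.le hz, hcl, fun t ht => ?_⟩
  rcases le_total t T with htT | htT
  · have h1 := norm_duhamel_le (κ := 1) (V := Kv * ‖y₀‖) y₀ zero_le_two (by positivity)
      (fun s hs x => by simpa only [max_eq_left hs] using hSb s x)
      (fun i s hs => (hv1 i hs).trans (mul_le_mul_of_nonneg_left (Real.exp_le_exp.2 (by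
        have : 0 ≤ (γ + 1) * s := by positivity
        linarith)) (by positivity))) ht (g := g)
    refine h1.trans ?_
    have h2 : Real.exp (1 * t) ≤ Real.exp ((1 + γ) * T) * Real.exp (-(γ * t)) := by
      rw [← Real.exp_add]
      refine Real.exp_le_exp.2 ?_
      have := mul_le_mul_of_nonneg_left htT (by linarith : 0 ≤ 1 + γ)
      linarith
    calc _ = 2 * Real.exp (1 * t) * ((1 + Kv * G) * ‖y₀‖) := by ring
      _ ≤ 2 * (Real.exp ((1 + γ) * T) * Real.exp (-(γ * t))) * ((1 + Kv * G) * ‖y₀‖) := by gcongr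
      _ = (2 * Real.exp ((1 + γ) * T) * (1 + Kv * G)) * Real.exp (-(γ * t)) * ‖y₀‖ := by ring
      _ ≤ _ := by
          gcongr
          rw [hCdef, add_mul]
          have : 0 ≤ Ks * (1 + Kv * G) := by positivity
          linarith
  · have hFn : ∀ n s, inner ℂ (b n) (∑ i, v i s • g i) = ∑ i, v i s * inner ℂ (b n) (g i) := by
      intro n s
      simp only [inner_sum, inner_smul_right]
    -- After `T` the controlled modes are at rest, so discarding them does not change the solution.
    have heq : duhamel S y₀ v g t = duhamel S' y₀ v g t := by
      refine hilbertBasis_ext b fun n => ?_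
      rw [inner_duhamel (m := fun n => modeY (lam n) δ) hS hSc (fun n => continuous_modeY _ _) y₀
        hvc g ht, inner_duhamel (m := ms) hS' hSc' hmsc y₀ hvc g ht]
      by_cases h : N ≤ n
      · simp only [hms, if_pos h]
      · simp only [hms, if_neg h, Complex.ofReal_zero, zero_mul, zero_smul, zero_add,
          intervalIntegral.integral_zero]
        have hPc := continuous_modeP (lam n) δ
        have hZc := continuous_modeZ (lam n) δ
        refine respY_eq_zero (f := fun s => inner ℂ (b n) (∑ i, v i s • g i)) (T := T) ?_ ?_ ?_ ?_
          htT
        · simp only [hFn]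
          fun_prop
        · intro s hs
          simp only [hvT _ s hs, zero_smul, Finset.sum_const_zero, inner_zero_right]
        · have h1 := fun m => (hVm m ⟨n, not_le.1 h⟩).1
          simp only at h1
          have h2 := integral_mul_combine hVd c (fun i => inner ℂ (b n) (g i))
            (p := fun s => modeP (lam n) δ (-s)) (by fun_prop) T
          simp only [h1] at h2
          simp only [hFn]
          refine h2.trans ?_
          simp [hc]
        · have h1 := fun m => (hVm m ⟨n, not_le.1 h⟩).2
          simp only at h1
          have h2 := integral_mul_combine hVd c (fun i => inner ℂ (b n) (g i))
            (p := fun s => modeZ (lam n) δ (-s)) (by fun_prop) T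
          simp only [h1] at h2
          simp only [hFn]
          refine h2.trans ?_
          simp
    rw [heq]
    have h1 := norm_duhamel_le (κ := -γ) (V := Kv * ‖y₀‖) y₀ hKs0 (by positivity)
      (fun s hs x => by simpa only [max_eq_left hs, neg_mul] using hSb' s x)
      (fun i s hs => (hv1 i hs).trans_eq (by ring_nf)) ht (g := g)
    refine h1.trans ?_
    calc _ = (Ks * (1 + Kv * G)) * Real.exp (-(γ * t)) * ‖y₀‖ := by
          rw [hG]
          ring_nf
      _ ≤ _ := by
          gcongr
          rw [hCdef, add_mul]
          have : 0 ≤ 2 * Real.exp ((1 + γ) * T) * (1 + Kv * G) := by positivity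
          linarith

/-- The representation of a control that vanishes at time `T` by `w = v' + δ v`. -/
theorem eq_neg_integral_kernel {v : ℝ → ℂ} {δ T : ℝ} (hv : ContDiff ℝ 2 v) (hT : v T = 0) (t : ℝ) :
    v t = -∫ s in t..T, (kernel δ (t - s) : ℂ) * (deriv v s + δ * v s) := by
  have h0 := hv.continuous
  have h1 := (differentiable_deriv hv).continuous
  have hk := continuous_kernel δ
  have hd : ∀ s, HasDerivAt (fun s => (kernel δ (t - s) : ℂ) * v s)
      ((kernel δ (t - s) : ℂ) * (deriv v s + δ * v s)) s := by
    intro s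
    have h2 : HasDerivAt (fun s => (kernel δ (t - s) : ℂ)) _ s :=
      ((hasDerivAt_kernel δ (t - s)).scomp s ((hasDerivAt_id s).const_sub t)).ofReal_comp
    refine (h2.mul ((hv.differentiable two_ne_zero) s).hasDerivAt).congr_deriv ?_
    simp only [smul_eq_mul]
    push_cast
    ring
  rw [intervalIntegral.integral_eq_sub_of_hasDerivAt (fun s _ => hd s)
    (Continuous.intervalIntegrable (by fun_prop) _ _), hT]
  simp

end PIDE

/-! ### The main theorem -/

theorem Complexification.ofReal_mem_domain {H : Type*} [NormedAddCommGroup H]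
    [InnerProductSpace ℝ H] {A : H →ₗ.[ℝ] H} {x : H} (hx : x ∈ A.domain) :
    Complexification.ofReal x ∈ (Complexification.mapPMap A).domain :=
  ⟨hx, A.domain.zero_mem⟩

theorem mainTheorem3 {H : Type*} [NormedAddCommGroup H] [InnerProductSpace ℝ H] [CompleteSpace H]
    (A : H →ₗ.[ℝ] H) (hA_dense : Dense (A.domain : Set H)) (hA_selfAdjoint : IsSelfAdjoint A)
    (hA_pos : ∀ x : A.domain, x ≠ 0 → 0 < inner ℝ (A x) (x : H))
    (hA_resolvent : PIDE.HasCompactResolvent A)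
    (B : H →L[ℝ] H)
    (φ : HilbertBasis ℕ ℝ H) (lam : ℕ → ℝ) (hlam : Monotone lam)
    (hφ : ∀ n, ∃ h : φ n ∈ A.domain, A ⟨φ n, h⟩ = lam n • φ n)
    (δ γ : ℝ) (hδ : 0 < δ) (hγ : 0 < γ) (hγδ : γ < δ + 1)
    (N M : ℕ) (hN : N = PIDE.unstableDim lam δ γ) (hM : M = PIDE.maxMultiplicity lam N)
    (Φ : Fin M → Complexification H)
    (hΦ :
      (PIDE.SemisimpleSpectrum lam δ N ∧
        (∀ i : Fin M, Φ i = Complexification.ofReal (φ i)) ∧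
        PIDE.SemisimpleRankCondition B φ lam δ N Φ) ∨
      (¬ PIDE.SemisimpleSpectrum lam δ N ∧
        (∀ i : Fin M, Φ i ∈ Submodule.span ℂ
          (Set.range fun k : Fin N => Complexification.ofReal (φ k))) ∧
        PIDE.JordanRankCondition B φ lam δ N Φ)) :
    (∀ i : Fin M, Φ i ∈ (Complexification.mapPMap A).domain) ∧
    (∀ T : ℝ, 0 < T → ∃ C : ℝ, ∀ y₀ : Complexification H,
      ∃ v w : Fin M → ℝ → ℂ,
        (∀ i, ContinuousOn (v i) (Set.Ici 0)) ∧
        (∀ i, MeasureTheory.MemLp (w i) 2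
          (MeasureTheory.volume.restrict (Set.Ioc 0 T))) ∧
        (∀ i, ∀ t ∈ Set.Icc 0 T,
          v i t = -∫ s in t..T, (PIDE.kernel δ (t - s) : ℂ) * w i s) ∧
        (∀ i, (∫ t in (0 : ℝ)..T, ‖w i t‖ ^ 2) ≤ C * ‖y₀‖ ^ 2) ∧
        (∀ i, ∀ t, T ≤ t → v i t = 0 ∧ w i t = 0) ∧
        PIDE.Stabilizes A B δ γ C (PIDE.control Φ v) y₀) ∧
    (∃ C : ℝ, ∀ y₀ : Complexification H,
      ∃ v : Fin M → ℝ → ℂ,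
        (∀ i, ContDiffOn ℝ 2 (v i) (Set.Ici 0)) ∧
        (∀ i, ∀ t, 0 < t →
          ‖v i t‖ + ‖deriv (v i) t‖ + ‖deriv (deriv (v i)) t‖
            ≤ C * Real.exp (-(γ * t)) * ‖y₀‖) ∧
        PIDE.Stabilizes A B δ γ C (PIDE.control Φ v) y₀) := by
  have hlam0 : ∀ n, 0 ≤ lam n := by
    intro n
    obtain ⟨h, hn⟩ := hφ n
    have h1 := hA_pos ⟨φ n, h⟩ fun h0 => φ.orthonormal.ne_zero n (congrArg Subtype.val h0)
    rw [hn, inner_smul_left, real_inner_self_eq_norm_sq, φ.orthonormal.1 n] at h1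
    simpa using h1.le
  have hΦD : ∀ i : Fin M, Φ i ∈ (Complexification.mapPMap A).domain := by
    intro i
    rcases hΦ with ⟨-, h, -⟩ | ⟨-, h, -⟩
    · rw [h i]
      exact Complexification.ofReal_mem_domain (hφ i).1
    · refine Submodule.span_le.2 ?_ (h i)
      rintro _ ⟨k, rfl⟩
      exact Complexification.ofReal_mem_domain (hφ k).1
  subst hN
  have hC := PIDE.rows_independent (B := B) (φ := φ) hδ
    (hΦ.imp (fun h => h.2.2) fun h => h.2.2)
  have key := fun {T : ℝ} (hT : 0 < T) => PIDE.exists_stabilizing_control hA_dense hA_selfAdjoint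
    hA_resolvent B φ hlam hlam0 hφ hδ hγ hγδ Φ hC hT
  refine ⟨hΦD, fun T hT => ?_, ?_⟩
  · obtain ⟨C, hC0, hCv⟩ := key hT
    -- The second entry bounds ∫₀ᵀ|w|², since w = v' + δv satisfies |w| ≤ (1+δ)C|y₀| pointwise.
    refine ⟨max C (T * ((1 + δ) * C) ^ 2), fun y₀ => ?_⟩
    obtain ⟨v, hvd, hvT, hvb, hst⟩ := hCv y₀
    have hwc : ∀ i, Continuous fun t => deriv (v i) t + δ * v i t := fun i =>
      (PIDE.differentiable_deriv (hvd i)).continuous.add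
        (continuous_const.mul (hvd i).continuous)
    have hwb : ∀ i t, 0 ≤ t → ‖deriv (v i) t + δ * v i t‖ ≤ (1 + δ) * C * ‖y₀‖ := by
      intro i t ht
      have h1 := hvb i t ht
      have h2 : Real.exp (-(γ * t)) ≤ 1 := Real.exp_le_one_iff.2 (by
        have := mul_nonneg hγ.le ht
        linarith)
      have h3 : C * Real.exp (-(γ * t)) * ‖y₀‖ ≤ C * 1 * ‖y₀‖ := by gcongr
      have h4 : ‖deriv (v i) t + δ * v i t‖ ≤ ‖deriv (v i) t‖ + δ * ‖v i t‖ := by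
        refine (norm_add_le _ _).trans_eq ?_
        rw [norm_mul, Complex.norm_real, Real.norm_of_nonneg hδ.le]
      have h5 := norm_nonneg (v i t)
      have h6 := norm_nonneg (deriv (v i) t)
      have h7 := norm_nonneg (deriv (deriv (v i)) t)
      have h8 : δ * ‖v i t‖ ≤ δ * (C * ‖y₀‖) := mul_le_mul_of_nonneg_left (by linarith) hδ.le
      linarith
    refine ⟨v, fun i t => deriv (v i) t + δ * v i t, fun i => (hvd i).continuous.continuousOn,
      fun i => ?_, fun i t _ => PIDE.eq_neg_integral_kernel (hvd i) (hvT i T le_rfl) t,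
      fun i => ?_, fun i t ht => ⟨hvT i t ht, ?_⟩, hst.mono (le_max_left _ _)⟩
    · refine MeasureTheory.MemLp.of_bound (hwc i).aestronglyMeasurable ((1 + δ) * C * ‖y₀‖) ?_
      filter_upwards [MeasureTheory.ae_restrict_mem measurableSet_Ioc] with t ht
      exact hwb i t ht.1.le
    · have h1 := intervalIntegral.integral_mono_on (μ := MeasureTheory.volume) (a := 0) (b := T) hT.le
        (f := fun t => ‖deriv (v i) t + δ * v i t‖ ^ 2)
        (g := fun _ => ((1 + δ) * C * ‖y₀‖) ^ 2)
        (((hwc i).norm.pow 2).intervalIntegrable _ _) intervalIntegrable_const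
        fun t ht => pow_le_pow_left₀ (norm_nonneg _) (hwb i t ht.1) 2
      refine h1.trans ?_
      rw [intervalIntegral.integral_const, smul_eq_mul, sub_zero, mul_pow _ ‖y₀‖, ← mul_assoc]
      gcongr
      exact le_max_right _ _
    · change deriv (v i) t + δ * v i t = 0
      rw [hvT i t ht, PIDE.deriv_eq_zero_of_vanishing ((hvd i).differentiable two_ne_zero)
        (hvT i) t ht, mul_zero, add_zero]
  · obtain ⟨C, -, hCv⟩ := key one_pos
    refine ⟨C, fun y₀ => ?_⟩
    obtain ⟨v, hvd, -, hvb, hst⟩ := hCv y₀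
    exact ⟨v, fun i => (hvd i).contDiffOn, fun i t ht => hvb i t ht.le, hst⟩
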